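/- Let $n > m > \ell \geq 2$ be integers, write $[g,h] = g^{-1}h^{-1}gh$, and let \begin{align*} G &= \langle\, x, y, z \mid x^{2^n} = 1,\ y^{2^m} = 1,\ z^{2^\ell} = 1,\ [y,x] = z,\ [z,x] = z^{-2},\ [z,y] = z^{-2} \,\rangle, \\ H &= \langle\, a, b, c \mid a^{2^n} = 1,\ b^{2^m} = a^{2^m},\ c^{2^\ell} = 1,\ [b,a] = c,\ [c,a] = c^{-2},\ [c,b] = c^{-2} \,\rangle. \end{align*} Then $G$ and $H$ are finite, and $\mathbb{C}G \cong \mathbb{C}H$ as $\mathbb{C}$-algebras, but $\mathbb{Q}G \not\cong \mathbb{Q}H$ as $\mathbb{Q}$-algebras. Moreover, each of $G$ and $H$ has a maximal subgroup that is abelian, all irreducible complex representations of $G$ and of $H$ have degree $1$ or $2$, and, writing $\mathrm{CS}(\Gamma)$ for the set of conjugacy classes of cyclic subgroups of a group $\Gamma$, $$|\mathrm{CS}(H)| - |\mathrm{CS}(G)| = (n-m)\,2^{m-1}(2^{\ell-1}-1) > 0.$$ -/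

import Mathlib

/-- The commutator convention `[g, h] = g⁻¹ h⁻¹ g h` (Mathlib's `⁅g, h⁆` is `g h g⁻¹ h⁻¹`). -/
def comm' {Γ : Type*} [Group Γ] (g h : Γ) : Γ := g⁻¹ * h⁻¹ * g * h

/-- The relators of `G`, where the generators `0, 1, 2` are `x, y, z`; the relation `u = v` is
given by the relator `u * v⁻¹`. -/
def relsG (n m l : ℕ) : Set (FreeGroup (Fin 3)) :=
  let x : FreeGroup (Fin 3) := FreeGroup.of 0
  let y : FreeGroup (Fin 3) := FreeGroup.of 1
  let z : FreeGroup (Fin 3) := FreeGroup.of 2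
  {x ^ 2 ^ n, y ^ 2 ^ m, z ^ 2 ^ l,
    comm' y x * z⁻¹, comm' z x * (z⁻¹ ^ 2)⁻¹, comm' z y * (z⁻¹ ^ 2)⁻¹}

/-- The relators of `H`, where the generators `0, 1, 2` are `a, b, c`. -/
def relsH (n m l : ℕ) : Set (FreeGroup (Fin 3)) :=
  let a : FreeGroup (Fin 3) := FreeGroup.of 0
  let b : FreeGroup (Fin 3) := FreeGroup.of 1
  let c : FreeGroup (Fin 3) := FreeGroup.of 2
  {a ^ 2 ^ n, b ^ 2 ^ m * (a ^ 2 ^ m)⁻¹, c ^ 2 ^ l,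
    comm' b a * c⁻¹, comm' c a * (c⁻¹ ^ 2)⁻¹, comm' c b * (c⁻¹ ^ 2)⁻¹}

/-- `⟨x, y, z | x^(2^n) = 1, y^(2^m) = 1, z^(2^l) = 1, [y,x] = z, [z,x] = z⁻², [z,y] = z⁻²⟩`. -/
abbrev GroupG (n m l : ℕ) : Type := PresentedGroup (relsG n m l)

/-- `⟨a, b, c | a^(2^n) = 1, b^(2^m) = a^(2^m), c^(2^l) = 1, [b,a] = c, [c,a] = c⁻²,
[c,b] = c⁻²⟩`. -/
abbrev GroupH (n m l : ℕ) : Type := PresentedGroup (relsH n m l)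

/-- Conjugacy in `Γ`, as an equivalence relation on the cyclic subgroups of `Γ`. -/
def cyclicSubgroupSetoid (Γ : Type*) [Group Γ] : Setoid {K : Subgroup Γ // IsCyclic K} where
  r K L := ∃ g : Γ, K.1.map (MulAut.conj g).toMonoidHom = L.1
  iseqv :=
    { refl := fun K => ⟨1, by ext x; simp⟩
      symm := by
        rintro K L ⟨g, hg⟩
        refine ⟨g⁻¹, ?_⟩
        rw [← hg, Subgroup.map_map]
        ext x
        simp [mul_assoc]
      trans := by
        rintro K L M ⟨g, hg⟩ ⟨h, hh⟩
        refine ⟨h * g, ?_⟩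
        rw [← hh, ← hg, Subgroup.map_map]
        ext x
        simp [mul_assoc] }

/-- The set of conjugacy classes of cyclic subgroups of `Γ`. -/
abbrev CyclicSubgroupClasses (Γ : Type*) [Group Γ] : Type _ :=
  Quotient (cyclicSubgroupSetoid Γ)

/-- `Γ` has a maximal subgroup that is abelian. -/
def HasAbelianMaximalSubgroup (Γ : Type*) [Group Γ] : Prop :=
  ∃ A : Subgroup Γ, IsCoatom A ∧ IsMulCommutative A

/-!
Both groups are fibre products over `(ℤ/2)²` of the abelian group `ℤ/2ⁿ × ℤ/2ᵐ` and the dihedral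
group of order `2 ^ (l + 2)`: the relations give every element the form `xⁱ yʲ zᵏ`
(`exists_eq_zpow_mul_zpow_mul_zpow`), and the generators are realised by pairs whose dihedral parts
are two reflections and a rotation (`Ambient.fibre`, `GroupG.exists_injective_hom`,
`GroupH.exists_injective_hom`). The two groups differ only in the map from the abelian factor to
`(ℤ/2)²`, encoded by the parameter `e`. The elements whose dihedral part is a rotation form an
abelian subgroup of index two. It is maximal, and an irreducible representation is spanned by a
common eigenvector of this subgroup and one translate of it
(`finrank_eq_one_or_two_of_index_two`).

Over `ℂ` the group algebra of `⟨a²⟩` contains a square root `μ` of `a⁻²`, which is central in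
`ℂ[H]`. Replacing `b` by `b * μ` turns the relation `b ^ 2 ^ m = a ^ 2 ^ m` into `y ^ 2 ^ m = 1` and
keeps the commutator relations, and this is invertible: `nonempty_algEquiv_complex`.

Over `ℚ` the algebras are told apart by `HasCentralRoot`: the existence of a primitive `2ⁿ`-th root
of unity in the centre of a noncommutative simple factor. In `ℚ[G]` such an element is built from
`(U + U') * (W + W⁻¹)`, where `U = yx` and `U'` are conjugate of order `2ⁿ` and `W` is a power of
`x`: on the factor where `z` acts as a fourth root of unity and `x ^ 2 ^ (n - 1)` as `-1`, each of
the two sums is a unit times a square root of `2` (`hasCentralRoot`). In `ℚ[H]` a central element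
killed by all commutative quotients is supported on the abelian subgroup of rotations, which has
exponent `2 ^ (n - 1)` only; Frobenius endomorphisms at primes given by Dirichlet's theorem then
exclude the root of unity (`eq_zero_of_pow_eq_neg`, `not_hasCentralRoot`).

As the groups are `2`-groups, classes of cyclic subgroups are classes of elements under conjugation
and odd powers. In coordinates these are explicit orbits of triples of integers
(`refl_conj_odd_zpow_iff`, `rot_conj_odd_zpow_iff`). The rotations with even second coordinate give
the same number for both groups; the other orbits are counted by representatives, using the number
of orbits of `1 + 2ᵐℤ` on `ℤ/2ᴺ` (`card_orbitSetoid`).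
-/

/-! ### Groups with an abelian subgroup of index two -/

/-- The family acts by scalars on a minimal nonzero invariant subspace, since the intersection of
such a subspace with an eigenspace of a member of the family is again invariant. -/
theorem exists_common_eigenvector {V : Type*} [AddCommGroup V] [Module ℂ V]
    [FiniteDimensional ℂ V] [Nontrivial V] (S : Set (Module.End ℂ V))
    (hS : ∀ f ∈ S, ∀ g ∈ S, Commute f g) :
    ∃ v : V, v ≠ 0 ∧ ∀ f ∈ S, ∃ c : ℂ, f v = c • v := by
  obtain ⟨W, ⟨hW0, hWinv⟩, hWmin⟩ := IsArtinian.set_has_minimal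
    {W : Submodule ℂ V | W ≠ ⊥ ∧ ∀ f ∈ S, ∀ w ∈ W, f w ∈ W} ⟨⊤, by simp, by simp⟩
  obtain ⟨v, hvW, hv0⟩ := W.exists_mem_ne_zero_of_ne_bot hW0
  refine ⟨v, hv0, fun f hf => ?_⟩
  have : Nontrivial W := (Submodule.nontrivial_iff_ne_bot).2 hW0
  obtain ⟨c, hc⟩ := Module.End.exists_eigenvalue (f.restrict (hWinv f hf))
  obtain ⟨w, hw⟩ := hc.exists_hasEigenvector
  have hw1 : f (w : V) = c • (w : V) := by
    simpa using congrArg Subtype.val hw.apply_eq_smul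
  refine ⟨c, ?_⟩
  have hE : ¬ (W ⊓ LinearMap.ker (f - c • 1) < W) := by
    refine hWmin _ ⟨?_, ?_⟩
    · refine (Submodule.ne_bot_iff _).2 ⟨w, ⟨w.2, ?_⟩, ?_⟩
      · simp [hw1]
      · simpa using hw.2
    · rintro g hg u ⟨huW, hu⟩
      refine ⟨hWinv g hg u huW, ?_⟩
      have hu' : f u = c • u := by simpa [sub_eq_zero] using hu
      have hfg : f (g u) = g (f u) := LinearMap.congr_fun (hS f hf g hg) u
      simp [hfg, hu']
  have hle : W ≤ LinearMap.ker (f - c • 1) := by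
    by_contra h
    exact hE (lt_of_le_of_ne inf_le_left fun h' => h (inf_eq_left.1 h'))
  simpa [sub_eq_zero] using hle hvW

theorem eq_top_of_invariant {Γ V : Type*} [Group Γ] [AddCommGroup V] [Module ℂ V]
    {ρ : Representation ℂ Γ V} (hρ : ρ.IsIrreducible) (W : Submodule ℂ V) {v : V} (hv : v ∈ W)
    (hv0 : v ≠ 0) (hW : ∀ g, ∀ w ∈ W, ρ g w ∈ W) : W = ⊤ := by
  rcases hρ.eq_bot_or_eq_top ⟨W, fun g w hw => hW g w hw⟩ with h | h
  · have h' : W = ⊥ := congrArg Subrepresentation.toSubmodule h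
    rw [h'] at hv
    exact absurd (by simpa using hv) hv0
  · exact congrArg Subrepresentation.toSubmodule h

theorem finiteDimensional_of_isIrreducible {Γ V : Type*} [Group Γ] [Finite Γ] [AddCommGroup V]
    [Module ℂ V] {ρ : Representation ℂ Γ V} (hρ : ρ.IsIrreducible) [Nontrivial V] :
    FiniteDimensional ℂ V := by
  obtain ⟨v, hv⟩ := exists_ne (0 : V)
  have htop : Submodule.span ℂ (Set.range fun g => ρ g v) = ⊤ := by
    refine eq_top_of_invariant hρ _ (Submodule.subset_span ⟨1, by simp⟩) hv fun g w hw => ?_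
    refine Submodule.span_induction ?_ (by simp) (fun a b _ _ ha hb => ?_)
      (fun c a _ ha => ?_) hw
    · rintro _ ⟨h, rfl⟩
      exact Submodule.subset_span ⟨g * h, by simp⟩
    · rw [map_add]; exact add_mem ha hb
    · rw [map_smul]; exact Submodule.smul_mem _ _ ha
  exact Module.finite_def.2 (htop ▸ Submodule.fg_span (Set.finite_range _))

/-- If `v` is a common eigenvector of the abelian subgroup `A` and `x ∉ A`, then `v` and `ρ x v`
span an invariant subspace. -/
theorem finrank_eq_one_or_two_of_index_two {Γ V : Type*} [Group Γ] [Finite Γ] [AddCommGroup V]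
    [Module ℂ V] (A : Subgroup Γ) (hA : A.index = 2) (hcomm : IsMulCommutative A)
    (ρ : Representation ℂ Γ V) (hρ : ρ.IsIrreducible) :
    Module.finrank ℂ V = 1 ∨ Module.finrank ℂ V = 2 := by
  have hnt : Nontrivial V := by
    by_contra h
    rw [not_nontrivial_iff_subsingleton] at h
    obtain ⟨a, b, hab⟩ := hρ.exists_pair_ne
    exact hab (Subrepresentation.toSubmodule_injective (Subsingleton.elim _ _))
  have hfd := finiteDimensional_of_isIrreducible hρ
  obtain ⟨v, hv0, hv⟩ := exists_common_eigenvector (ρ '' (A : Set Γ)) (by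
    rintro _ ⟨a, ha, rfl⟩ _ ⟨b, hb, rfl⟩
    have hab : a * b = b * a := congrArg Subtype.val (hcomm.is_comm.comm ⟨a, ha⟩ ⟨b, hb⟩)
    change ρ a * ρ b = ρ b * ρ a
    rw [← map_mul, hab, map_mul])
  obtain ⟨x, hx⟩ : ∃ x, x ∉ A := by
    by_contra! h
    have : A = ⊤ := (Subgroup.eq_top_iff' A).2 h
    simp [this] at hA
  set W := Submodule.span ℂ {v, ρ x v} with hWdef
  have hvW : v ∈ W := Submodule.subset_span (by simp)
  have hxW : ρ x v ∈ W := Submodule.subset_span (by simp)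
  have key : ∀ g, ρ g v ∈ W := by
    intro g
    by_cases hg : g ∈ A
    · obtain ⟨c, hc⟩ := hv _ ⟨g, hg, rfl⟩
      rw [hc]; exact W.smul_mem _ hvW
    · have hxg : x⁻¹ * g ∈ A := by
        rw [Subgroup.mul_mem_iff_of_index_two hA]
        simp [hx, hg]
      obtain ⟨c, hc⟩ := hv _ ⟨_, hxg, rfl⟩
      have : ρ g v = ρ x (ρ (x⁻¹ * g) v) := by
        rw [← Module.End.mul_apply, ← map_mul, mul_inv_cancel_left]
      rw [this, hc, map_smul]
      exact W.smul_mem _ hxW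
  have htop : W = ⊤ := by
    refine eq_top_of_invariant hρ W hvW hv0 fun g w hw => ?_
    obtain ⟨a, b, rfl⟩ := Submodule.mem_span_pair.1 hw
    have : ρ g (ρ x v) = ρ (g * x) v := by rw [map_mul]; rfl
    rw [map_add, map_smul, map_smul, this]
    exact add_mem (W.smul_mem _ (key _)) (W.smul_mem _ (key _))
  have hle : Module.finrank ℂ V ≤ 2 := by
    classical
    have hW2 : W = Submodule.span ℂ (({v, ρ x v} : Finset V) : Set V) := by simp [hWdef]
    rw [← finrank_top ℂ V, ← htop, hW2]
    exact (finrank_span_finset_le_card _).trans Finset.card_le_two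
  have hpos : 0 < Module.finrank ℂ V := Module.finrank_pos
  omega

theorem isCoatom_of_index_two {Γ : Type*} [Group Γ] (A : Subgroup Γ) (hA : A.index = 2) :
    IsCoatom A := by
  refine ⟨fun h => by simp [h] at hA, fun B hB => ?_⟩
  obtain ⟨x, hxB, hxA⟩ := SetLike.exists_of_lt hB
  refine (Subgroup.eq_top_iff' B).2 fun g => ?_
  by_cases hg : g ∈ A
  · exact hB.le hg
  · have : x⁻¹ * g ∈ A := by
      rw [Subgroup.mul_mem_iff_of_index_two hA]
      simp [hxA, hg]
    simpa using B.mul_mem hxB (hB.le this)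

/-! ### Normal forms from the commutator relations -/

section NormalForm

variable {P : Type*} [Group P] {x y z : P}

theorem mul_eq_of_comm'_eq {u v w : P} (h : comm' u v = w) : u * v = v * u * w := by
  rw [← h, comm']; group

theorem semiconjBy_of_comm'_eq_inv_sq {u : P} (h : comm' z u = z⁻¹ ^ 2) : SemiconjBy u z⁻¹ z := by
  have h1 := mul_eq_of_comm'_eq h
  rw [SemiconjBy, h1]
  group

theorem zpow_mul_zpow_of_semiconjBy {u : P} (h : SemiconjBy u z⁻¹ z) (i : ℤ) :
    ∀ k : ℤ, ∃ k' : ℤ, z ^ k * u ^ i = u ^ i * z ^ k' := by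
  have h1 : ∀ k : ℤ, z ^ k * u = u * z ^ (-k) := fun k => by
    have := (h.zpow_right k).eq
    rw [inv_zpow'] at this
    exact this.symm
  have h2 : ∀ k : ℤ, z ^ k * u⁻¹ = u⁻¹ * z ^ (-k) := fun k => by
    rw [eq_inv_mul_iff_mul_eq, ← mul_assoc, ← neg_neg k, ← h1 (-k)]
    simp
  induction i using Int.induction_on with
  | zero => exact fun k => ⟨k, by simp⟩
  | succ i ih =>
    intro k
    obtain ⟨k', hk'⟩ := ih k
    exact ⟨-k', by rw [zpow_add_one, ← mul_assoc, hk', mul_assoc, h1, mul_assoc]⟩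
  | pred i ih =>
    intro k
    obtain ⟨k', hk'⟩ := ih k
    exact ⟨-k', by rw [zpow_sub_one, ← mul_assoc, hk', mul_assoc, h2, mul_assoc]⟩

theorem mul_zpow_of_comm' (hyx : comm' y x = z) (hx : SemiconjBy x z⁻¹ z) (i : ℤ) :
    ∃ e : ℤ, y * x ^ i = x ^ i * y * z ^ e := by
  have h1 := mul_eq_of_comm'_eq hyx
  have h2 : y * x⁻¹ = x⁻¹ * y * z := by
    have hz : z * x⁻¹ = x⁻¹ * z⁻¹ := by
      rw [eq_inv_mul_iff_mul_eq, ← mul_assoc, mul_inv_eq_iff_eq_mul, ← hx.inv_right.eq, inv_inv]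
    have : x⁻¹ * y = y * (z * x⁻¹) := by
      rw [inv_mul_eq_iff_eq_mul, ← mul_assoc y, ← mul_assoc x, ← mul_assoc x, ← h1]; simp
    rw [this, hz]; simp [mul_assoc]
  induction i using Int.induction_on with
  | zero => exact ⟨0, by simp⟩
  | succ i ih =>
    obtain ⟨e, he⟩ := ih
    obtain ⟨e', he'⟩ := zpow_mul_zpow_of_semiconjBy hx 1 e
    rw [zpow_one] at he'
    refine ⟨1 + e', ?_⟩
    rw [zpow_add_one, ← mul_assoc, he, mul_assoc, he', mul_assoc (x ^ (i : ℤ)), ← mul_assoc y, h1,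
      zpow_add, zpow_one]
    simp only [mul_assoc]
  | pred i ih =>
    obtain ⟨e, he⟩ := ih
    obtain ⟨e', he'⟩ := zpow_mul_zpow_of_semiconjBy hx (-1) e
    rw [zpow_neg_one] at he'
    refine ⟨1 + e', ?_⟩
    rw [zpow_sub_one, ← mul_assoc, he, mul_assoc, he', mul_assoc (x ^ (-(i : ℤ))), ← mul_assoc y,
      h2, zpow_add, zpow_one]
    simp only [mul_assoc]

theorem exists_eq_zpow_mul_zpow_mul_zpow (hyx : comm' y x = z) (hzx : comm' z x = z⁻¹ ^ 2)
    (hzy : comm' z y = z⁻¹ ^ 2) (hgen : Subgroup.closure {x, y, z} = ⊤) (g : P) :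
    ∃ i j k : ℤ, g = x ^ i * y ^ j * z ^ k := by
  have hx := semiconjBy_of_comm'_eq_inv_sq hzx
  have hy := semiconjBy_of_comm'_eq_inv_sq hzy
  have zmul : ∀ e i j k : ℤ, ∃ k' : ℤ,
      z ^ e * (x ^ i * y ^ j * z ^ k) = x ^ i * y ^ j * z ^ k' := by
    intro e i j k
    obtain ⟨e', he'⟩ := zpow_mul_zpow_of_semiconjBy hx i e
    obtain ⟨e'', he''⟩ := zpow_mul_zpow_of_semiconjBy hy j e'
    refine ⟨e'' + k, ?_⟩
    rw [← mul_assoc, ← mul_assoc, he', mul_assoc (x ^ i), he'', zpow_add]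
    simp only [mul_assoc]
  have ymul : ∀ i j k e : ℤ, ∃ k' : ℤ,
      x ^ i * y * z ^ e * (y ^ j * z ^ k) = x ^ i * y ^ (j + 1) * z ^ k' := by
    intro i j k e
    obtain ⟨e', he'⟩ := zpow_mul_zpow_of_semiconjBy hy j e
    refine ⟨e' + k, ?_⟩
    rw [mul_assoc (x ^ i * y), ← mul_assoc (z ^ e), he', zpow_add z, add_comm j 1, zpow_add y, zpow_one]
    simp only [mul_assoc]
  have hg : g ∈ Subgroup.closure {x, y, z} := hgen ▸ Subgroup.mem_top g
  induction hg using Subgroup.closure_induction_left with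
  | one => exact ⟨0, 0, 0, by simp⟩
  | mul_left u hu v _ ih =>
    obtain ⟨i, j, k, rfl⟩ := ih
    rcases hu with rfl | rfl | rfl
    · exact ⟨i + 1, j, k, by rw [add_comm, zpow_add, zpow_one]; simp only [mul_assoc]⟩
    · obtain ⟨e, he⟩ := mul_zpow_of_comm' hyx hx i
      obtain ⟨k', hk'⟩ := ymul i j k e
      exact ⟨i, j + 1, k', by rw [← hk', ← he]; simp only [mul_assoc]⟩
    · obtain ⟨k', hk'⟩ := zmul 1 i j k
      exact ⟨i, j, k', by rw [← hk', zpow_one]⟩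
  | inv_mul_cancel u hu v _ ih =>
    obtain ⟨i, j, k, rfl⟩ := ih
    rcases hu with rfl | rfl | rfl
    · exact ⟨i - 1, j, k, by
        rw [sub_eq_neg_add, zpow_add, zpow_neg_one]; simp only [mul_assoc]⟩
    · obtain ⟨e, he⟩ := mul_zpow_of_comm' hyx hx i
      obtain ⟨e', he'⟩ := zpow_mul_zpow_of_semiconjBy hy (-1) (-e)
      obtain ⟨e'', he''⟩ := zpow_mul_zpow_of_semiconjBy hy j e'
      refine ⟨i, j - 1, e'' + k, ?_⟩
      have h1 : u⁻¹ * x ^ i = x ^ i * u⁻¹ * z ^ e' := by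
        rw [inv_mul_eq_iff_eq_mul, mul_assoc (x ^ i), ← zpow_neg_one u, ← he', ← mul_assoc u, he]
        simp [mul_assoc]
      rw [← mul_assoc, ← mul_assoc, h1, mul_assoc (x ^ i * u⁻¹), he'', zpow_add,
        sub_eq_neg_add, zpow_add, zpow_neg_one]
      simp only [mul_assoc]
    · obtain ⟨k', hk'⟩ := zmul (-1) i j k
      exact ⟨i, j, k', by rw [← hk', zpow_neg_one]⟩

end NormalForm

/-- Moves a predicate such as `Even` or `Odd` along an identity of integers. -/
theorem pred_of_eq {p : ℤ → Prop} {a b : ℤ} (h : p a) (hab : b = a) : p b := hab ▸ h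

/-! ### A fibre product of an abelian group and a dihedral group -/

/-- The direct product of `ℤ/2ⁿ × ℤ/2ᵐ`, written multiplicatively, and the dihedral group of order
`2 ^ (l + 2)`. -/
abbrev Ambient (n m l : ℕ) : Type :=
  Multiplicative (ZMod (2 ^ n) × ZMod (2 ^ m)) × DihedralGroup (2 ^ (l + 1))

namespace Ambient

variable {n m l : ℕ}

/-- The element with abelian part `(i, j)` and dihedral part the rotation by `k`. -/
def rot (i j k : ℤ) : Ambient n m l := (Multiplicative.ofAdd ((i : ZMod _), (j : ZMod _)), .r k)

/-- The element with abelian part `(i, j)` and dihedral part the reflection with index `k`. -/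
def refl (i j k : ℤ) : Ambient n m l := (Multiplicative.ofAdd ((i : ZMod _), (j : ZMod _)), .sr k)

theorem rot_mul_rot (i j k i' j' k' : ℤ) :
    (rot i j k : Ambient n m l) * rot i' j' k' = rot (i + i') (j + j') (k + k') := by
  simp [rot, ← ofAdd_add]

theorem rot_mul_refl (i j k i' j' k' : ℤ) :
    (rot i j k : Ambient n m l) * refl i' j' k' = refl (i + i') (j + j') (k' - k) := by
  simp [rot, refl, ← ofAdd_add]

theorem refl_mul_rot (i j k i' j' k' : ℤ) :
    (refl i j k : Ambient n m l) * rot i' j' k' = refl (i + i') (j + j') (k + k') := by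
  simp [rot, refl, ← ofAdd_add]

theorem refl_mul_refl (i j k i' j' k' : ℤ) :
    (refl i j k : Ambient n m l) * refl i' j' k' = rot (i + i') (j + j') (k' - k) := by
  simp [rot, refl, ← ofAdd_add]

theorem rot_zero : (rot 0 0 0 : Ambient n m l) = 1 := by
  simp [rot]

theorem rot_inv (i j k : ℤ) : (rot i j k : Ambient n m l)⁻¹ = rot (-i) (-j) (-k) := by
  rw [inv_eq_iff_mul_eq_one, rot_mul_rot]; simp [rot_zero]

theorem refl_inv (i j k : ℤ) : (refl i j k : Ambient n m l)⁻¹ = refl (-i) (-j) k := by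
  rw [inv_eq_iff_mul_eq_one, refl_mul_refl]; simp [rot_zero]

theorem rot_zpow (i j k t : ℤ) : (rot i j k : Ambient n m l) ^ t = rot (t * i) (t * j) (t * k) := by
  simp [rot, ← ofAdd_zsmul, mul_comm]

theorem refl_zpow_two_mul (i j k t : ℤ) :
    (refl i j k : Ambient n m l) ^ (2 * t) = rot (2 * t * i) (2 * t * j) 0 := by
  rw [zpow_mul, zpow_two, refl_mul_refl, rot_zpow]
  congr 1 <;> ring

theorem refl_zpow_two_mul_add_one (i j k t : ℤ) :
    (refl i j k : Ambient n m l) ^ (2 * t + 1) = refl ((2 * t + 1) * i) ((2 * t + 1) * j) k := by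
  rw [zpow_add_one, refl_zpow_two_mul, rot_mul_refl]
  congr 1 <;> ring

theorem rot_eq_rot_iff {i j k i' j' k' : ℤ} :
    (rot i j k : Ambient n m l) = rot i' j' k' ↔
      i ≡ i' [ZMOD 2 ^ n] ∧ j ≡ j' [ZMOD 2 ^ m] ∧ k ≡ k' [ZMOD 2 ^ (l + 1)] := by
  simp only [rot, Prod.ext_iff, EmbeddingLike.apply_eq_iff_eq, DihedralGroup.r.injEq,
    ZMod.intCast_eq_intCast_iff, and_assoc]
  push_cast
  rfl

theorem refl_eq_refl_iff {i j k i' j' k' : ℤ} :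
    (refl i j k : Ambient n m l) = refl i' j' k' ↔
      i ≡ i' [ZMOD 2 ^ n] ∧ j ≡ j' [ZMOD 2 ^ m] ∧ k ≡ k' [ZMOD 2 ^ (l + 1)] := by
  simp only [refl, Prod.ext_iff, EmbeddingLike.apply_eq_iff_eq, DihedralGroup.sr.injEq,
    ZMod.intCast_eq_intCast_iff, and_assoc]
  push_cast
  rfl

theorem rot_ne_refl {i j k i' j' k' : ℤ} : (rot i j k : Ambient n m l) ≠ refl i' j' k' := by
  simp [rot, refl, Prod.ext_iff]

/-- The fibre product of the two factors of `Ambient n m l` over `(ℤ/2)²`: the dihedral part is a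
rotation or a reflection according to the parity of `i + e * j`, and its index has the parity
of `j`. The parameter `e = 1` gives a model of `GroupG`, and `e = 0` one of `GroupH`. -/
def fibre (n m l : ℕ) (e : ℤ) : Subgroup (Ambient n m l) where
  carrier := {g | ∃ i j k : ℤ, Even (k - j) ∧
    (Even (i + e * j) ∧ g = rot i j k ∨ Odd (i + e * j) ∧ g = refl i j k)}
  one_mem' := ⟨0, 0, 0, by simp, Or.inl ⟨by simp, rot_zero.symm⟩⟩
  mul_mem' := by
    rintro _ _ ⟨i, j, k, hk, ⟨h, rfl⟩ | ⟨h, rfl⟩⟩ ⟨i', j', k', hk', ⟨h', rfl⟩ | ⟨h', rfl⟩⟩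
    · exact ⟨_, _, _, pred_of_eq (hk.add hk') (by ring),
        Or.inl ⟨pred_of_eq (h.add h') (by ring), rot_mul_rot ..⟩⟩
    · exact ⟨_, _, _, pred_of_eq ((hk'.sub hk).sub (even_two_mul j)) (by ring),
        Or.inr ⟨pred_of_eq (h.add_odd h') (by ring), rot_mul_refl ..⟩⟩
    · exact ⟨_, _, _, pred_of_eq (hk.add hk') (by ring),
        Or.inr ⟨pred_of_eq (h.add_even h') (by ring), refl_mul_rot ..⟩⟩
    · exact ⟨_, _, _, pred_of_eq ((hk'.sub hk).sub (even_two_mul j)) (by ring),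
        Or.inl ⟨pred_of_eq (h.add_odd h') (by ring), refl_mul_refl ..⟩⟩
  inv_mem' := by
    rintro _ ⟨i, j, k, hk, ⟨h, rfl⟩ | ⟨h, rfl⟩⟩
    · exact ⟨_, _, _, pred_of_eq (hk.neg) (by ring),
        Or.inl ⟨pred_of_eq (h.neg) (by ring), rot_inv ..⟩⟩
    · exact ⟨_, _, _, pred_of_eq (hk.add (even_two_mul j)) (by ring),
        Or.inr ⟨pred_of_eq (h.neg) (by ring), refl_inv ..⟩⟩

theorem rot_mem_fibre {e i j k : ℤ} (h : Even (i + e * j)) (hk : Even (k - j)) :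
    rot i j k ∈ fibre n m l e := ⟨i, j, k, hk, Or.inl ⟨h, rfl⟩⟩

theorem refl_mem_fibre {e i j k : ℤ} (h : Odd (i + e * j)) (hk : Even (k - j)) :
    refl i j k ∈ fibre n m l e := ⟨i, j, k, hk, Or.inr ⟨h, rfl⟩⟩

theorem modEq_two_of_modEq_two_pow {k : ℕ} (hk : 0 < k) {a b : ℤ} (h : a ≡ b [ZMOD 2 ^ k]) :
    a ≡ b [ZMOD 2] :=
  h.of_dvd (dvd_pow_self 2 hk.ne')

theorem even_iff_of_modEq_two {a b : ℤ} (h : a ≡ b [ZMOD 2]) : Even a ↔ Even b := by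
  rw [Int.even_iff, Int.even_iff, h.eq]

theorem rot_mem_fibre_iff (hn : 0 < n) (hm : 0 < m) {e i j k : ℤ} :
    rot i j k ∈ fibre n m l e ↔ Even (i + e * j) ∧ Even (k - j) := by
  refine ⟨?_, fun h => rot_mem_fibre h.1 h.2⟩
  rintro ⟨i', j', k', hk', ⟨h', h⟩ | ⟨-, h⟩⟩
  · rw [rot_eq_rot_iff] at h
    have h1 := modEq_two_of_modEq_two_pow hn h.1
    have h2 := modEq_two_of_modEq_two_pow hm h.2.1
    have h3 := modEq_two_of_modEq_two_pow l.succ_pos h.2.2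
    exact ⟨(even_iff_of_modEq_two (h1.add (h2.mul_left e))).2 h',
      (even_iff_of_modEq_two (h3.sub h2)).2 hk'⟩
  · exact absurd h rot_ne_refl

theorem refl_mem_fibre_iff (hn : 0 < n) (hm : 0 < m) {e i j k : ℤ} :
    refl i j k ∈ fibre n m l e ↔ Odd (i + e * j) ∧ Even (k - j) := by
  refine ⟨?_, fun h => refl_mem_fibre h.1 h.2⟩
  rintro ⟨i', j', k', hk', ⟨-, h⟩ | ⟨h', h⟩⟩
  · exact absurd h.symm rot_ne_refl
  · rw [refl_eq_refl_iff] at h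
    have h1 := modEq_two_of_modEq_two_pow hn h.1
    have h2 := modEq_two_of_modEq_two_pow hm h.2.1
    have h3 := modEq_two_of_modEq_two_pow l.succ_pos h.2.2
    rw [← Int.not_even_iff_odd] at h' ⊢
    exact ⟨fun h4 => h' ((even_iff_of_modEq_two (h1.add (h2.mul_left e))).1 h4),
      (even_iff_of_modEq_two (h3.sub h2)).2 hk'⟩

end Ambient

/-! ### The presented groups are fibre products -/

section Presentation

open Ambient

variable {n m l : ℕ} {P : Type*} [Group P] {x y z : P} {δ : ℤ} {f : P →* Ambient n m l}

/-- The images of `xⁱ yʲ`, up to the index of the dihedral part. The parameter `δ` is `0` for `GroupG`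
and `1` for `GroupH`. -/
theorem map_zpow_mul_zpow (hfx : f x = refl 1 0 0) (hfy : f y = refl δ 1 (-1)) (i j : ℤ) :
    (Even (i + j) → ∃ k : ℤ, Even (k - j) ∧ f (x ^ i * y ^ j) = rot (i + δ * j) j k) ∧
    (Odd (i + j) → ∃ k : ℤ, Even (k - j) ∧ f (x ^ i * y ^ j) = refl (i + δ * j) j k) := by
  rw [map_mul, map_zpow, map_zpow, hfx, hfy]
  obtain ⟨s, rfl | rfl⟩ := Int.even_or_odd' i <;> obtain ⟨t, rfl | rfl⟩ := Int.even_or_odd' j <;>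
    constructor <;> intro h <;>
    first
    | (exfalso; revert h; simp [parity_simps]; done)
    | skip
  · exact ⟨0, by simp, by rw [refl_zpow_two_mul, refl_zpow_two_mul, rot_mul_rot]; congr 1 <;> ring⟩
  · exact ⟨-1, ⟨-1 - t, by ring⟩, by
      rw [refl_zpow_two_mul, refl_zpow_two_mul_add_one, rot_mul_refl]; congr 1 <;> ring⟩
  · exact ⟨0, by simp, by
      rw [refl_zpow_two_mul, refl_zpow_two_mul_add_one, refl_mul_rot]; congr 1 <;> ring⟩
  · exact ⟨-1, ⟨-1 - t, by ring⟩, by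
      rw [refl_zpow_two_mul_add_one, refl_zpow_two_mul_add_one, refl_mul_refl]; congr 1 <;> ring⟩

/-- The relations force `xⁱ yʲ zᵏ` to be trivial as soon as its image is. -/
theorem injective_of_presentation (hyx : comm' y x = z)
    (hzx : comm' z x = z⁻¹ ^ 2) (hzy : comm' z y = z⁻¹ ^ 2)
    (hgen : Subgroup.closure {x, y, z} = ⊤) (hx : x ^ 2 ^ n = 1)
    (hy : y ^ 2 ^ m = x ^ (δ * 2 ^ m)) (hz : z ^ 2 ^ l = 1)
    (hfx : f x = refl 1 0 0) (hfy : f y = refl δ 1 (-1)) (hfz : f z = rot 0 0 2) :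
    Function.Injective f := by
  rw [injective_iff_map_eq_one]
  intro g hg
  obtain ⟨i, j, k, rfl⟩ := exists_eq_zpow_mul_zpow_mul_zpow hyx hzx hzy hgen g
  rw [map_mul, map_zpow f z, hfz, rot_zpow] at hg
  rcases Int.even_or_odd (i + j) with h | h
  swap
  · obtain ⟨k', -, hk'⟩ := (map_zpow_mul_zpow hfx hfy i j).2 h
    rw [hk', refl_mul_rot, ← rot_zero] at hg
    exact absurd hg.symm rot_ne_refl
  obtain ⟨k', -, hk'⟩ := (map_zpow_mul_zpow hfx hfy i j).1 h
  rw [hk', rot_mul_rot, ← rot_zero, rot_eq_rot_iff] at hg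
  obtain ⟨h1, h2, h6⟩ := hg
  rw [mul_zero, add_zero, Int.modEq_zero_iff_dvd] at h1 h2
  obtain ⟨j', rfl⟩ := h2
  obtain ⟨s, hs⟩ := h1
  have hxy : x ^ i * y ^ ((2 : ℤ) ^ m * j') = 1 := by
    have h3 : y ^ ((2 : ℤ) ^ m) = x ^ (δ * 2 ^ m) := by rw [← hy]; exact_mod_cast zpow_natCast y _
    have h4 : x ^ ((2 : ℤ) ^ n) = 1 := by rw [← hx]; exact_mod_cast zpow_natCast x _
    rw [zpow_mul, h3, ← zpow_mul, ← zpow_add, mul_assoc δ, hs, zpow_mul, h4, one_zpow]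
  rw [hxy, one_mul]
  rw [hxy, map_one, ← rot_zero, rot_eq_rot_iff] at hk'
  obtain ⟨-, -, h5⟩ := hk'
  obtain ⟨t, ht⟩ := dvd_sub (Int.modEq_zero_iff_dvd.1 h6) (Int.modEq_zero_iff_dvd.1 h5.symm)
  have hkt : k = 2 ^ l * t := by rw [pow_succ] at ht; linarith
  have h7 : z ^ ((2 : ℤ) ^ l) = 1 := by rw [← hz]; exact_mod_cast zpow_natCast z _
  rw [hkt, zpow_mul, h7, one_zpow]

theorem range_of_presentation (hyx : comm' y x = z)
    (hzx : comm' z x = z⁻¹ ^ 2) (hzy : comm' z y = z⁻¹ ^ 2)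
    (hgen : Subgroup.closure {x, y, z} = ⊤)
    (hfx : f x = refl 1 0 0) (hfy : f y = refl δ 1 (-1)) (hfz : f z = rot 0 0 2) :
    f.range = fibre n m l (1 - δ) := by
  apply le_antisymm
  · rintro _ ⟨g, rfl⟩
    obtain ⟨i, j, k, rfl⟩ := exists_eq_zpow_mul_zpow_mul_zpow hyx hzx hzy hgen g
    rw [map_mul, map_zpow f z, hfz, rot_zpow]
    rcases Int.even_or_odd (i + j) with h | h
    · obtain ⟨k', hk, hk'⟩ := (map_zpow_mul_zpow hfx hfy i j).1 h
      rw [hk', rot_mul_rot]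
      exact rot_mem_fibre (pred_of_eq h (by ring))
        (pred_of_eq (hk.add (even_two_mul k)) (by ring))
    · obtain ⟨k', hk, hk'⟩ := (map_zpow_mul_zpow hfx hfy i j).2 h
      rw [hk', refl_mul_rot]
      exact refl_mem_fibre (pred_of_eq h (by ring))
        (pred_of_eq (hk.add (even_two_mul k)) (by ring))
  · rintro _ ⟨i, j, k, hk, h⟩
    rcases h with ⟨h, rfl⟩ | ⟨h, rfl⟩
    · obtain ⟨k', hk1, hk'⟩ := (map_zpow_mul_zpow hfx hfy (i - δ * j) j).1
        (pred_of_eq h (by ring))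
      obtain ⟨t, ht⟩ := hk.sub hk1
      refine ⟨x ^ (i - δ * j) * y ^ j * z ^ t, ?_⟩
      rw [map_mul, map_zpow f z, hfz, rot_zpow, hk', rot_mul_rot]
      congr 1 <;> linarith
    · obtain ⟨k', hk1, hk'⟩ := (map_zpow_mul_zpow hfx hfy (i - δ * j) j).2
        (pred_of_eq h (by ring))
      obtain ⟨t, ht⟩ := hk.sub hk1
      refine ⟨x ^ (i - δ * j) * y ^ j * z ^ t, ?_⟩
      rw [map_mul, map_zpow f z, hfz, rot_zpow, hk', refl_mul_rot]
      congr 1 <;> linarith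

end Presentation

section PresentedGroups

open Ambient PresentedGroup

variable {n m l : ℕ}

theorem closure_of_eq_top (rels : Set (FreeGroup (Fin 3))) :
    Subgroup.closure {(of 0 : PresentedGroup rels), of 1, of 2} = ⊤ := by
  rw [← closure_range_of rels]
  congr 1
  ext g
  simp [Fin.exists_fin_succ, eq_comm]

namespace GroupG

theorem of_zero_pow : (of 0 : GroupG n m l) ^ 2 ^ n = 1 :=
  one_of_mem (x := FreeGroup.of 0 ^ 2 ^ n) (by simp [relsG])

theorem of_one_pow : (of 1 : GroupG n m l) ^ 2 ^ m = 1 :=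
  one_of_mem (x := FreeGroup.of 1 ^ 2 ^ m) (by simp [relsG])

theorem of_two_pow : (of 2 : GroupG n m l) ^ 2 ^ l = 1 :=
  one_of_mem (x := FreeGroup.of 2 ^ 2 ^ l) (by simp [relsG])

theorem comm_of_one_of_zero : comm' (of 1 : GroupG n m l) (of 0) = of 2 :=
  mk_eq_mk_of_mul_inv_mem (rels := relsG n m l) (x := comm' (.of 1) (.of 0)) (y := .of 2) (by simp [relsG])

theorem comm_of_two_of_zero : comm' (of 2 : GroupG n m l) (of 0) = (of 2)⁻¹ ^ 2 :=
  mk_eq_mk_of_mul_inv_mem (rels := relsG n m l) (x := comm' (.of 2) (.of 0)) (y := (FreeGroup.of 2)⁻¹ ^ 2) (by simp [relsG])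

theorem comm_of_two_of_one : comm' (of 2 : GroupG n m l) (of 1) = (of 2)⁻¹ ^ 2 :=
  mk_eq_mk_of_mul_inv_mem (rels := relsG n m l) (x := comm' (.of 2) (.of 1)) (y := (FreeGroup.of 2)⁻¹ ^ 2) (by simp [relsG])

/-- The universal property of the presentation. -/
def lift {P : Type*} [Group P] (x y z : P) (hx : x ^ 2 ^ n = 1) (hy : y ^ 2 ^ m = 1)
    (hz : z ^ 2 ^ l = 1) (hyx : comm' y x = z) (hzx : comm' z x = z⁻¹ ^ 2)
    (hzy : comm' z y = z⁻¹ ^ 2) : GroupG n m l →* P :=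
  toGroup (f := ![x, y, z]) (by
    have := hyx; have := hzx; have := hzy
    simp only [comm', inv_pow] at *
    rintro r (rfl | rfl | rfl | rfl | rfl | rfl) <;> simp [comm', *])

end GroupG

namespace GroupH

theorem of_zero_pow : (of 0 : GroupH n m l) ^ 2 ^ n = 1 :=
  one_of_mem (x := FreeGroup.of 0 ^ 2 ^ n) (by simp [relsH])

theorem of_one_pow : (of 1 : GroupH n m l) ^ 2 ^ m = of 0 ^ 2 ^ m :=
  mk_eq_mk_of_mul_inv_mem (x := .of 1 ^ 2 ^ m) (y := .of 0 ^ 2 ^ m) (by simp [relsH])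

theorem of_two_pow : (of 2 : GroupH n m l) ^ 2 ^ l = 1 :=
  one_of_mem (x := FreeGroup.of 2 ^ 2 ^ l) (by simp [relsH])

theorem comm_of_one_of_zero : comm' (of 1 : GroupH n m l) (of 0) = of 2 :=
  mk_eq_mk_of_mul_inv_mem (rels := relsH n m l) (x := comm' (.of 1) (.of 0)) (y := .of 2) (by simp [relsH])

theorem comm_of_two_of_zero : comm' (of 2 : GroupH n m l) (of 0) = (of 2)⁻¹ ^ 2 :=
  mk_eq_mk_of_mul_inv_mem (rels := relsH n m l) (x := comm' (.of 2) (.of 0)) (y := (FreeGroup.of 2)⁻¹ ^ 2) (by simp [relsH])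

theorem comm_of_two_of_one : comm' (of 2 : GroupH n m l) (of 1) = (of 2)⁻¹ ^ 2 :=
  mk_eq_mk_of_mul_inv_mem (rels := relsH n m l) (x := comm' (.of 2) (.of 1)) (y := (FreeGroup.of 2)⁻¹ ^ 2) (by simp [relsH])

/-- The universal property of the presentation. -/
def lift {P : Type*} [Group P] (a b c : P) (ha : a ^ 2 ^ n = 1) (hb : b ^ 2 ^ m = a ^ 2 ^ m)
    (hc : c ^ 2 ^ l = 1) (hba : comm' b a = c) (hca : comm' c a = c⁻¹ ^ 2)
    (hcb : comm' c b = c⁻¹ ^ 2) : GroupH n m l →* P :=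
  toGroup (f := ![a, b, c]) (by
    have := hba; have := hca; have := hcb
    simp only [comm', inv_pow] at *
    rintro r (rfl | rfl | rfl | rfl | rfl | rfl) <;> simp [comm', *])

end GroupH

end PresentedGroups

namespace Ambient

variable {n m l : ℕ}

theorem rot_pow_two_pow (k : ℕ) (i j t : ℤ) :
    (rot i j t : Ambient n m l) ^ 2 ^ k = rot (2 ^ k * i) (2 ^ k * j) (2 ^ k * t) := by
  rw [← zpow_natCast, rot_zpow]
  push_cast
  rfl

theorem refl_pow_two_pow {k : ℕ} (hk : 0 < k) (i j t : ℤ) :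
    (refl i j t : Ambient n m l) ^ 2 ^ k = rot (2 ^ k * i) (2 ^ k * j) 0 := by
  obtain ⟨k, rfl⟩ := Nat.exists_eq_add_of_lt hk
  have h := refl_zpow_two_mul (n := n) (m := m) (l := l) i j t (2 ^ k)
  rw [← pow_succ'] at h
  rw [← zpow_natCast, zero_add, ← h]
  push_cast
  rfl

theorem comm'_refl_refl (δ : ℤ) :
    comm' (refl δ 1 (-1)) (refl 1 0 0) = (rot 0 0 2 : Ambient n m l) := by
  rw [comm', refl_inv, refl_inv, refl_mul_refl, rot_mul_refl, refl_mul_refl]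
  congr 1; ring

theorem comm'_rot_refl (i j k : ℤ) :
    comm' (rot 0 0 2) (refl i j k) = (rot 0 0 2 : Ambient n m l)⁻¹ ^ 2 := by
  rw [comm', rot_inv, refl_inv, rot_mul_refl, refl_mul_rot, refl_mul_refl, sq, rot_mul_rot]
  congr 1 <;> ring

theorem exists_eq_rot_or_eq_refl (g : Ambient n m l) :
    ∃ i j k : ℤ, g = rot i j k ∨ g = refl i j k := by
  obtain ⟨⟨i, j⟩, k | k⟩ := g <;>
    obtain ⟨i, rfl⟩ := ZMod.intCast_surjective i <;>
    obtain ⟨j, rfl⟩ := ZMod.intCast_surjective j <;>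
    obtain ⟨k, rfl⟩ := ZMod.intCast_surjective k
  · exact ⟨i, j, k, Or.inl rfl⟩
  · exact ⟨i, j, k, Or.inr rfl⟩

/-- The elements whose dihedral part is a rotation. -/
def rotations (n m l : ℕ) : Subgroup (Ambient n m l) where
  carrier := {g | ∃ i j k : ℤ, g = rot i j k}
  one_mem' := ⟨0, 0, 0, rot_zero.symm⟩
  mul_mem' := by
    rintro _ _ ⟨i, j, k, rfl⟩ ⟨i', j', k', rfl⟩
    exact ⟨_, _, _, rot_mul_rot ..⟩
  inv_mem' := by
    rintro _ ⟨i, j, k, rfl⟩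
    exact ⟨_, _, _, rot_inv ..⟩

theorem rot_mem_rotations (i j k : ℤ) : rot i j k ∈ rotations n m l := ⟨i, j, k, rfl⟩

theorem refl_notMem_rotations (i j k : ℤ) : refl i j k ∉ rotations n m l := by
  rintro ⟨i', j', k', h⟩
  exact rot_ne_refl h.symm

theorem commute_of_mem_rotations {g h : Ambient n m l} (hg : g ∈ rotations n m l)
    (hh : h ∈ rotations n m l) : g * h = h * g := by
  obtain ⟨i, j, k, rfl⟩ := hg
  obtain ⟨i', j', k', rfl⟩ := hh
  rw [rot_mul_rot, rot_mul_rot]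
  congr 1 <;> ring

variable {P : Type*} [Group P]

theorem isMulCommutative_comap_rotations {f : P →* Ambient n m l} (hf : Function.Injective f) :
    IsMulCommutative ((rotations n m l).comap f) :=
  ⟨⟨fun a b => Subtype.ext (hf (by
    simpa using commute_of_mem_rotations (Subgroup.mem_comap.1 a.2) (Subgroup.mem_comap.1 b.2)))⟩⟩

theorem index_comap_rotations {f : P →* Ambient n m l} {x : P} {i j k : ℤ}
    (hx : f x = refl i j k) : ((rotations n m l).comap f).index = 2 := by
  refine Subgroup.index_eq_two_iff.2 ⟨x, fun b => ?_⟩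
  rw [Subgroup.mem_comap, Subgroup.mem_comap, map_mul, hx]
  obtain ⟨i', j', k', h | h⟩ := exists_eq_rot_or_eq_refl (f b)
  · rw [h, rot_mul_refl]
    exact Or.inr ⟨rot_mem_rotations .., refl_notMem_rotations _ _ _⟩
  · rw [h, refl_mul_refl]
    exact Or.inl ⟨rot_mem_rotations .., refl_notMem_rotations _ _ _⟩

end Ambient

section Models

open Ambient PresentedGroup

theorem GroupG.exists_injective_hom {n m : ℕ} (l : ℕ) (hn : 0 < n) (hm : 0 < m) :
    ∃ f : GroupG n m l →* Ambient n m l, Function.Injective f ∧ f.range = fibre n m l 1 ∧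
      f (of 0) = refl 1 0 0 := by
  let f : GroupG n m l →* Ambient n m l := GroupG.lift (refl 1 0 0) (refl 0 1 (-1)) (rot 0 0 2)
    (by rw [refl_pow_two_pow hn, ← rot_zero, rot_eq_rot_iff]; simp)
    (by rw [refl_pow_two_pow hm, ← rot_zero, rot_eq_rot_iff]; simp)
    (by rw [rot_pow_two_pow, ← rot_zero, rot_eq_rot_iff]
        simp [pow_succ])
    (comm'_refl_refl _) (comm'_rot_refl ..) (comm'_rot_refl ..)
  have h0 : f (of 0) = refl 1 0 0 := toGroup.of _
  have h1 : f (of 1) = refl 0 1 (-1) := toGroup.of _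
  have h2 : f (of 2) = rot 0 0 2 := toGroup.of _
  refine ⟨f, ?_, ?_, h0⟩
  · exact injective_of_presentation comm_of_one_of_zero comm_of_two_of_zero comm_of_two_of_one
      (closure_of_eq_top _) of_zero_pow (by simp [of_one_pow]) of_two_pow h0 h1 h2
  · simpa using range_of_presentation comm_of_one_of_zero comm_of_two_of_zero
      comm_of_two_of_one (closure_of_eq_top _) h0 h1 h2

theorem GroupH.exists_injective_hom {n m : ℕ} (l : ℕ) (hn : 0 < n) (hm : 0 < m) :
    ∃ f : GroupH n m l →* Ambient n m l, Function.Injective f ∧ f.range = fibre n m l 0 ∧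
      f (of 0) = refl 1 0 0 := by
  let f : GroupH n m l →* Ambient n m l := GroupH.lift (refl 1 0 0) (refl 1 1 (-1)) (rot 0 0 2)
    (by rw [refl_pow_two_pow hn, ← rot_zero, rot_eq_rot_iff]; simp)
    (by rw [refl_pow_two_pow hm, refl_pow_two_pow hm, rot_eq_rot_iff]; simp)
    (by rw [rot_pow_two_pow, ← rot_zero, rot_eq_rot_iff]
        simp [pow_succ])
    (comm'_refl_refl _) (comm'_rot_refl ..) (comm'_rot_refl ..)
  have h0 : f (of 0) = refl 1 0 0 := toGroup.of _
  have h1 : f (of 1) = refl 1 1 (-1) := toGroup.of _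
  have h2 : f (of 2) = rot 0 0 2 := toGroup.of _
  refine ⟨f, ?_, ?_, h0⟩
  · exact injective_of_presentation comm_of_one_of_zero comm_of_two_of_zero comm_of_two_of_one
      (closure_of_eq_top _) of_zero_pow
      (by rw [of_one_pow, one_mul]; rw [← zpow_natCast]; push_cast; rfl) of_two_pow h0 h1 h2
  · simpa using range_of_presentation comm_of_one_of_zero comm_of_two_of_zero
      comm_of_two_of_one (closure_of_eq_top _) h0 h1 h2

end Models

/-! ### The complex group algebras -/

open Polynomial in
/-- Modulo `X ^ N - 1` the inverse of `X` has a square root over `ℂ`: interpolate square roots of the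
inverses of the `N`-th roots of unity. -/
theorem exists_X_pow_sub_one_dvd_sq_mul_X_sub_one {N : ℕ} (hN : N ≠ 0) :
    ∃ q : ℂ[X], X ^ N - 1 ∣ q ^ 2 * X - 1 := by
  have hsq : ∀ w : ℂ, ∃ r : ℂ, r ^ 2 = w⁻¹ := fun w =>
    IsAlgClosed.exists_pow_nat_eq _ two_pos
  choose r hr using hsq
  have : NeZero N := ⟨hN⟩
  have hinj : Set.InjOn (id : ℂ → ℂ) (nthRootsFinset N (1 : ℂ)) := fun _ _ _ _ h => h
  refine ⟨Lagrange.interpolate (nthRootsFinset N (1 : ℂ)) id r, ?_⟩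
  rw [X_pow_sub_one_eq_prod (Nat.pos_of_ne_zero hN) (Complex.isPrimitiveRoot_exp N hN)]
  refine Finset.prod_dvd_of_coprime
    (fun a _ b _ hab => pairwise_coprime_X_sub_C (s := id) (fun _ _ h => h) hab) fun w hw => ?_
  have hw1 : w ^ N = 1 := (mem_nthRootsFinset (Nat.pos_of_ne_zero hN) _).1 hw
  have hw0 : w ≠ 0 := fun h => by simp [h, hN] at hw1
  have heval : eval w (Lagrange.interpolate (nthRootsFinset N (1 : ℂ)) id r) = r w :=
    Lagrange.eval_interpolate_at_node r hinj hw
  rw [dvd_iff_isRoot, IsRoot, eval_sub, eval_mul, eval_pow, heval, hr]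
  simp [hw0]

theorem comm'_mul_left {P : Type*} [Group P] {u v w : P} (hu : Commute w u) (hv : Commute w v) :
    comm' (u * w) v = comm' u v := by
  have h1 : w⁻¹ * (u⁻¹ * (v⁻¹ * (u * w))) = u⁻¹ * (v⁻¹ * u) := by
    have : Commute w (u⁻¹ * (v⁻¹ * u)) :=
      (hu.inv_right).mul_right ((hv.inv_right).mul_right hu)
    rw [inv_mul_eq_iff_eq_mul, this.eq]; simp only [mul_assoc]
  simp only [comm', mul_inv_rev, mul_assoc] at h1 ⊢
  simpa only [mul_assoc] using congrArg (· * v) h1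

theorem comm'_mul_right {P : Type*} [Group P] {u v w : P} (hu : Commute w u) (hv : Commute w v) :
    comm' v (u * w) = comm' v u := by
  have h (a b : P) : comm' a b = (comm' b a)⁻¹ := by simp [comm', mul_assoc]
  rw [h, comm'_mul_left hu hv, ← h]

theorem comm'_map {P Q : Type*} [Group P] [Group Q] (f : P →* Q) (u v : P) :
    comm' (f u) (f v) = f (comm' u v) := by
  simp [comm']

section Twist

variable {P : Type*} [Group P] {x y z : P}

theorem commute_sq_of_comm' (hyx : comm' y x = z) (hzx : comm' z x = z⁻¹ ^ 2) :
    Commute (x ^ 2) y ∧ Commute (x ^ 2) z := by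
  have hx := semiconjBy_of_comm'_eq_inv_sq hzx
  have hx' : SemiconjBy x z z⁻¹ := by simpa using hx.inv_right
  refine ⟨?_, by rw [sq]; exact hx.mul_left hx'⟩
  have h1 := mul_eq_of_comm'_eq hyx
  have h2 : SemiconjBy x (y * z) y := by rw [SemiconjBy, h1, mul_assoc]
  have h3 : SemiconjBy x y (y * z) := by
    have := h2.mul_right hx
    rwa [mul_inv_cancel_right] at this
  rw [sq]
  exact h2.mul_left h3

variable {R : Type*} [Ring R] [Algebra ℂ R]

open Polynomial in
/-- A square root `q(A²)` of `A⁻²`, which commutes with every unit that commutes with `A²`. -/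
theorem exists_unit_aeval_sq {n : ℕ} (hn : 0 < n) {q : ℂ[X]}
    (hq : X ^ 2 ^ (n - 1) - 1 ∣ q ^ 2 * X - 1) (A : Rˣ) (hA : A ^ 2 ^ n = 1) :
    ∃ μ : Rˣ, (μ : R) = aeval ((A : R) ^ 2) q ∧ μ ^ 2 = A⁻¹ ^ 2 ∧
      ∀ B : Rˣ, Commute (A ^ 2) B → Commute μ B := by
  set T : R := (A : R) ^ 2 with hT
  have hT1 : T ^ 2 ^ (n - 1) = 1 := by
    rw [hT, ← pow_mul, ← pow_succ', Nat.sub_add_cancel hn, ← Units.val_pow_eq_pow_val, hA,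
      Units.val_one]
  have hroot : (aeval T q) ^ 2 * T = 1 := by
    obtain ⟨p, hp⟩ := hq
    have := congrArg (aeval T) hp
    simpa [hT1, sub_eq_zero] using this
  have hcomm : Commute (aeval T q) T := by
    have := (Commute.all q X).map (aeval T)
    simpa using this
  refine ⟨⟨aeval T q, aeval T q * T, by rw [← mul_assoc, ← sq, hroot],
    by rw [mul_assoc, ← hcomm.eq, ← mul_assoc, ← sq, hroot]⟩, rfl, ?_, ?_⟩
  · rw [inv_pow, eq_inv_iff_mul_eq_one]
    ext
    simpa using hroot
  · intro B hB
    have h1 : Commute T (B : R) := by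
      have := congrArg Units.val hB.eq
      simpa [hT, Commute, SemiconjBy] using this
    have h2 : Commute (aeval T q) (B : R) := by
      have hle : Algebra.adjoin ℂ {T} ≤ Subalgebra.centralizer ℂ {(B : R)} :=
        Algebra.adjoin_le (by simpa [Set.mem_centralizer_iff] using h1.eq.symm)
      have := hle (aeval_mem_adjoin_singleton ℂ T (p := q))
      exact (by simpa [Subalgebra.mem_centralizer_iff] using this : _ = _).symm
    ext
    exact h2

end Twist

open Polynomial PresentedGroup in
theorem nonempty_algEquiv_complex {n m l : ℕ} (hn : 0 < n) (hm : 0 < m) :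
    Nonempty (MonoidAlgebra ℂ (GroupG n m l) ≃ₐ[ℂ] MonoidAlgebra ℂ (GroupH n m l)) := by
  obtain ⟨q, hq⟩ := exists_X_pow_sub_one_dvd_sq_mul_X_sub_one (N := 2 ^ (n - 1)) (by simp)
  obtain ⟨m, rfl⟩ := Nat.exists_eq_add_of_lt hm
  rw [zero_add]
  let ιG := (MonoidAlgebra.of ℂ (GroupG n (m + 1) l)).toHomUnits
  let ιH := (MonoidAlgebra.of ℂ (GroupH n (m + 1) l)).toHomUnits
  obtain ⟨μ, hμ, hμ2, hμc⟩ := exists_unit_aeval_sq hn hq (ιH (of 0))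
    (by rw [← map_pow, GroupH.of_zero_pow, map_one])
  obtain ⟨ν, hν, hν2, hνc⟩ := exists_unit_aeval_sq hn hq (ιG (of 0))
    (by rw [← map_pow, GroupG.of_zero_pow, map_one])
  have hμ0 : Commute μ (ιH (of 0)) := hμc _ ((Commute.refl _).pow_left 2)
  have hν0 : Commute ν (ιG (of 0)) := hνc _ ((Commute.refl _).pow_left 2)
  obtain ⟨hH1, hH2⟩ := commute_sq_of_comm' (x := (of 0 : GroupH n (m + 1) l))
    GroupH.comm_of_one_of_zero GroupH.comm_of_two_of_zero
  obtain ⟨hG1, hG2⟩ := commute_sq_of_comm' (x := (of 0 : GroupG n (m + 1) l))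
    GroupG.comm_of_one_of_zero GroupG.comm_of_two_of_zero
  have hμ1 : Commute μ (ιH (of 1)) := hμc _ (by rw [← map_pow]; exact hH1.map ιH)
  have hμ3 : Commute μ (ιH (of 2)) := hμc _ (by rw [← map_pow]; exact hH2.map ιH)
  have hν1 : Commute ν⁻¹ (ιG (of 1)) := (hνc _ (by rw [← map_pow]; exact hG1.map ιG)).inv_left
  have hν3 : Commute ν⁻¹ (ιG (of 2)) := (hνc _ (by rw [← map_pow]; exact hG2.map ιG)).inv_left
  -- twisting `b` by a square root of `a⁻²` in the group algebra of `⟨a²⟩` turns the relation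
  -- `b ^ 2 ^ m = a ^ 2 ^ m` into `y ^ 2 ^ m = 1`
  let F : GroupG n (m + 1) l →* (MonoidAlgebra ℂ (GroupH n (m + 1) l))ˣ :=
    GroupG.lift (ιH (of 0)) (ιH (of 1) * μ) (ιH (of 2))
      (by rw [← map_pow, GroupH.of_zero_pow, map_one])
      (by rw [hμ1.symm.mul_pow, ← map_pow, GroupH.of_one_pow, map_pow, pow_succ', pow_mul μ, hμ2,
            ← pow_mul, inv_pow, mul_inv_cancel])
      (by rw [← map_pow, GroupH.of_two_pow, map_one])
      (by rw [comm'_mul_left hμ1 hμ0, comm'_map, GroupH.comm_of_one_of_zero])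
      (by rw [comm'_map, GroupH.comm_of_two_of_zero, map_pow, map_inv])
      (by rw [comm'_mul_right hμ1 hμ3, comm'_map, GroupH.comm_of_two_of_one, map_pow, map_inv])
  let E : GroupH n (m + 1) l →* (MonoidAlgebra ℂ (GroupG n (m + 1) l))ˣ :=
    GroupH.lift (ιG (of 0)) (ιG (of 1) * ν⁻¹) (ιG (of 2))
      (by rw [← map_pow, GroupG.of_zero_pow, map_one])
      (by rw [hν1.symm.mul_pow, ← map_pow, GroupG.of_one_pow, map_one, one_mul, pow_succ',
            pow_mul ν⁻¹, inv_pow ν, hν2, ← inv_pow, inv_inv, pow_mul])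
      (by rw [← map_pow, GroupG.of_two_pow, map_one])
      (by rw [comm'_mul_left hν1 hν0.inv_left, comm'_map, GroupG.comm_of_one_of_zero])
      (by rw [comm'_map, GroupG.comm_of_two_of_zero, map_pow, map_inv])
      (by rw [comm'_mul_right hν1 hν3, comm'_map, GroupG.comm_of_two_of_one, map_pow, map_inv])
  let φ := MonoidAlgebra.lift ℂ (MonoidAlgebra ℂ (GroupH n (m + 1) l)) _ ((Units.coeHom _).comp F)
  let ψ := MonoidAlgebra.lift ℂ (MonoidAlgebra ℂ (GroupG n (m + 1) l)) _ ((Units.coeHom _).comp E)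
  have hφ : ∀ g, φ (ιG g : MonoidAlgebra ℂ (GroupG n (m + 1) l)) = F g := fun g =>
    MonoidAlgebra.lift_of _ _
  have hψ : ∀ g, ψ (ιH g : MonoidAlgebra ℂ (GroupH n (m + 1) l)) = E g := fun g =>
    MonoidAlgebra.lift_of _ _
  have hF0 : F (of 0) = ιH (of 0) := toGroup.of _
  have hF1 : F (of 1) = ιH (of 1) * μ := toGroup.of _
  have hF2 : F (of 2) = ιH (of 2) := toGroup.of _
  have hE0 : E (of 0) = ιG (of 0) := toGroup.of _
  have hE1 : E (of 1) = ιG (of 1) * ν⁻¹ := toGroup.of _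
  have hE2 : E (of 2) = ιG (of 2) := toGroup.of _
  have hψμ : ψ μ = ν := by rw [hμ, ← aeval_algHom_apply, map_pow, hψ, hE0, hν]
  have hφν : φ ν = μ := by rw [hν, ← aeval_algHom_apply, map_pow, hφ, hF0, hμ]
  have hφν' : φ (ν⁻¹ : (MonoidAlgebra ℂ (GroupG n (m + 1) l))ˣ) =
      (μ⁻¹ : (MonoidAlgebra ℂ (GroupH n (m + 1) l))ˣ) := by
    rw [← mul_one (φ _), ← μ.mul_inv, ← hφν, ← mul_assoc, ← map_mul, ν.inv_mul, map_one, one_mul]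
  have hφE : (Units.map (φ : _ →* _)).comp E = ιH := by
    refine PresentedGroup.ext fun i => Units.ext ?_
    change φ (E (of i)) = ιH (of i)
    fin_cases i
    · change φ (E (of 0)) = ιH (of 0)
      rw [hE0, hφ, hF0]
    · change φ (E (of 1)) = ιH (of 1)
      rw [hE1, Units.val_mul, map_mul, hφ, hφν', hF1, ← Units.val_mul, mul_inv_cancel_right]
    · change φ (E (of 2)) = ιH (of 2)
      rw [hE2, hφ, hF2]
  have hψF : (Units.map (ψ : _ →* _)).comp F = ιG := by
    refine PresentedGroup.ext fun i => Units.ext ?_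
    change ψ (F (of i)) = ιG (of i)
    fin_cases i
    · change ψ (F (of 0)) = ιG (of 0)
      rw [hF0, hψ, hE0]
    · change ψ (F (of 1)) = ιG (of 1)
      rw [hF1, Units.val_mul, map_mul, hψ, hψμ, hE1, ← Units.val_mul, inv_mul_cancel_right]
    · change ψ (F (of 2)) = ιG (of 2)
      rw [hF2, hψ, hE2]
  refine ⟨AlgEquiv.ofAlgHom φ ψ (MonoidAlgebra.algHom_ext' (MonoidHom.ext fun g => ?_) (by ext))
    (MonoidAlgebra.algHom_ext' (MonoidHom.ext fun g => ?_) (by ext))⟩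
  · change φ (ψ (ιH g : MonoidAlgebra ℂ (GroupH n (m + 1) l))) = ιH g
    rw [hψ]
    exact congrArg Units.val (DFunLike.congr_fun hφE g)
  · change ψ (φ (ιG g : MonoidAlgebra ℂ (GroupG n (m + 1) l))) = ιG g
    rw [hφ]
    exact congrArg Units.val (DFunLike.congr_fun hψF g)

/-! ### An invariant of rational algebras -/

/-- A central element `v ≠ 0` of the kernel of every homomorphism to a commutative algebra with
`v ^ (K + 1) = -v`. If `R` is semisimple, such a `v` exhibits a primitive `2K`-th root of unity in
the centre of a noncommutative simple factor of `R`, when `K` is a power of two. -/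
def HasCentralRoot (K : ℕ) (R : Type) [Ring R] [Algebra ℚ R] : Prop :=
  ∃ v : R, v ≠ 0 ∧ (∀ r, Commute v r) ∧
    (∀ (S : Type) [CommRing S] [Algebra ℚ S] (φ : R →ₐ[ℚ] S), φ v = 0) ∧ v ^ (K + 1) = -v

theorem HasCentralRoot.of_algEquiv {K : ℕ} {R R' : Type} [Ring R] [Algebra ℚ R] [Ring R']
    [Algebra ℚ R'] (e : R ≃ₐ[ℚ] R') (h : HasCentralRoot K R) : HasCentralRoot K R' := by
  obtain ⟨v, hv0, hc, hk, hv⟩ := h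
  refine ⟨e v, by simpa using hv0, fun r => ?_, fun S _ _ φ => ?_, ?_⟩
  · have := (hc (e.symm r)).map e
    simpa using this
  · exact hk S (φ.comp (e : R →ₐ[ℚ] R'))
  · rw [← map_pow, hv, map_neg]

section Frobenius

variable {A : Type*} [CommGroup A]

theorem exists_smul_eq_map_intCast (v : MonoidAlgebra ℚ A) :
    ∃ (D : ℕ) (w : MonoidAlgebra ℤ A), D ≠ 0 ∧
      MonoidAlgebra.mapRingHom A (Int.castRingHom ℚ) w = D * v := by
  induction v using MonoidAlgebra.induction_linear with
  | zero => exact ⟨1, 0, one_ne_zero, by simp⟩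
  | add x y hx hy =>
    obtain ⟨D, w, hD, hw⟩ := hx
    obtain ⟨D', w', hD', hw'⟩ := hy
    refine ⟨D * D', D' * w + D * w', mul_ne_zero hD hD', ?_⟩
    rw [map_add, map_mul, map_mul, hw, hw', map_natCast, map_natCast]
    push_cast
    ring
  | single a r =>
    refine ⟨r.den, MonoidAlgebra.single a r.num, r.den_ne_zero, ?_⟩
    rw [MonoidAlgebra.mapRingHom_single, ← nsmul_eq_mul, MonoidAlgebra.smul_single, nsmul_eq_mul,
      Rat.den_mul_eq_num]
    rfl

/-- The Frobenius endomorphism is the identity on the coefficients and on the group elements. -/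
theorem pow_prime_eq_self {p : ℕ} [Fact p.Prime] (hA : ∀ a : A, a ^ p = a)
    (w : MonoidAlgebra (ZMod p) A) : w ^ p = w := by
  have : CharP (MonoidAlgebra (ZMod p) A) p :=
    charP_of_injective_algebraMap (algebraMap (ZMod p) (MonoidAlgebra (ZMod p) A)).injective p
  have h : frobenius (MonoidAlgebra (ZMod p) A) p = RingHom.id _ := by
    refine MonoidAlgebra.ringHom_ext (fun r => ?_) fun a => ?_
    · simp [frobenius_def, MonoidAlgebra.single_pow]
    · simp [frobenius_def, MonoidAlgebra.single_pow, hA]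
  simpa [frobenius_def] using DFunLike.congr_fun h w

/-- For a prime `p ≡ 1 + K` modulo `2K` the `p`-th power map is `v ↦ -v` on the given `v`, while
modulo `p` the Frobenius endomorphism fixes every element of the group algebra, as `p ≡ 1` modulo
the exponent of `A`. By Dirichlet's theorem there are arbitrarily large such primes. -/
theorem eq_zero_of_pow_eq_neg {s : ℕ} (hs : 0 < s) (hA : ∀ a : A, a ^ 2 ^ s = 1)
    {v : MonoidAlgebra ℚ A} (hv : v ^ (2 ^ s + 1) = -v) : v = 0 := by
  obtain ⟨D, w, hD, hw⟩ := exists_smul_eq_map_intCast v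
  suffices hw0 : w = 0 by
    rw [hw0, map_zero] at hw
    have h1 : (D : ℚ) • v = 0 := by rw [hw, ← nsmul_eq_mul, ← Nat.cast_smul_eq_nsmul ℚ]
    exact (smul_eq_zero.1 h1).resolve_left (by exact_mod_cast hD)
  ext a
  by_contra ha
  obtain ⟨p, hplt, hp, hmod⟩ := Nat.forall_exists_prime_gt_and_modEq
    ((w.coeff a).natAbs + D) (q := 2 * 2 ^ s) (a := 1 + 2 ^ s) (by positivity) (by
      rw [← pow_succ']
      refine Nat.Coprime.pow_right _ (Nat.coprime_two_right.2 ?_)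
      exact odd_one.add_even ((Nat.even_pow.2 ⟨even_two, hs.ne'⟩)))
  have : Fact p.Prime := ⟨hp⟩
  obtain ⟨r, hr⟩ : ∃ r, p = 1 + 2 ^ s * (2 * r + 1) := by
    have hle : 1 + 2 ^ s ≤ p := by
      by_contra! hlt
      have h1 := Nat.ModEq.eq_of_lt_of_lt hmod (by have := Nat.one_le_two_pow (n := s); omega)
        (by have := Nat.one_lt_two_pow hs.ne'; omega)
      omega
    obtain ⟨r, hr⟩ := (Nat.modEq_iff_dvd' hle).1 hmod.symm
    exact ⟨r, by rw [mul_add, mul_left_comm, ← mul_assoc, mul_one]; omega⟩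
  have hpodd : Odd p := by
    rw [hr]
    exact odd_one.add_even ((Nat.even_pow.2 ⟨even_two, hs.ne'⟩).mul_right _)
  have hvK : ∀ r : ℕ, v * (v ^ 2 ^ s) ^ (2 * r + 1) = -v := by
    have h1 : v * v ^ 2 ^ s = -v := by rw [← pow_succ', hv]
    intro r
    induction r with
    | zero => simpa using h1
    | succ r ih =>
      rw [show 2 * (r + 1) + 1 = (2 * r + 1) + 1 + 1 by ring, pow_succ, pow_succ, ← mul_assoc,
        ← mul_assoc, ih, neg_mul, h1, neg_neg, h1]
  have hvp : v ^ p = -v := by rw [hr, pow_add, pow_one, pow_mul, hvK]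
  have hwp : w ^ p = -(D : MonoidAlgebra ℤ A) ^ (p - 1) * w := by
    have hinj : Function.Injective (MonoidAlgebra.mapRingHom A (Int.castRingHom ℚ)) :=
      MonoidAlgebra.map_injective _ Int.cast_injective
    apply hinj
    rw [map_pow, hw, mul_pow, hvp, map_mul, map_neg, map_pow, map_natCast, hw]
    obtain ⟨k, hk⟩ := Nat.exists_eq_add_of_lt hp.pos
    rw [zero_add] at hk
    rw [hk, Nat.add_sub_cancel, pow_succ]
    ring
  have hmodp := congrArg (MonoidAlgebra.mapRingHom A (Int.castRingHom (ZMod p))) hwp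
  rw [map_pow, pow_prime_eq_self (fun a => by rw [hr, pow_add, pow_one, pow_mul, hA, one_pow,
    mul_one]), map_mul, map_neg, map_pow, map_natCast] at hmodp
  have hDp : ((D : MonoidAlgebra (ZMod p) A)) ^ (p - 1) = 1 := by
    have h1 : (D : ZMod p) ≠ 0 := by
      rw [Ne, ZMod.natCast_eq_zero_iff]
      exact fun h => absurd (Nat.le_of_dvd (Nat.pos_of_ne_zero hD) h) (by omega)
    have := congrArg (algebraMap (ZMod p) (MonoidAlgebra (ZMod p) A))
      (ZMod.pow_card_sub_one_eq_one h1)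
    rwa [map_pow, map_natCast, map_one] at this
  rw [hDp, neg_one_mul] at hmodp
  have hcoeff : ((w.coeff a : ℤ) : ZMod p) = -((w.coeff a : ℤ) : ZMod p) := by
    simpa using congrArg (fun u => u.coeff a) hmodp
  have h2 : ((2 * w.coeff a : ℤ) : ZMod p) = 0 := by
    push_cast
    linear_combination hcoeff
  rw [ZMod.intCast_zmod_eq_zero_iff_dvd] at h2
  have h3 : (p : ℤ) ∣ w.coeff a := by
    refine IsCoprime.dvd_of_dvd_mul_left ?_ h2
    exact_mod_cast Nat.isCoprime_iff_coprime.2 (Nat.coprime_two_right.2 hpodd)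
  have h4 := Int.le_of_dvd (abs_pos.2 ha) ((dvd_abs _ _).2 h3)
  rw [Int.abs_eq_natAbs] at h4
  omega

end Frobenius

/-! ### The rational group algebra of `GroupH` has no central root -/

section NoRoot

open Ambient

variable {P : Type} [Group P] {n m l : ℕ} {f : P →* Ambient n m l}

theorem coeff_conj_of_commute {v : MonoidAlgebra ℚ P} (hv : ∀ r, Commute v r) (u g : P) :
    v.coeff (u * g * u⁻¹) = v.coeff g := by
  have h := congrArg (fun r => r.coeff (u * g)) (hv (MonoidAlgebra.single u 1)).eq
  simpa [mul_assoc] using h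

/-- A central element killed by all homomorphisms to commutative algebras is supported on the
rotations: it is constant on the set of reflections with a given abelian part, as they are
conjugate, and the sum of these coefficients vanishes. -/
theorem coeff_eq_zero_of_map_eq_refl (hn : 0 < n) (hm : 0 < m)
    (hrange : f.range = fibre n m l 0) {v : MonoidAlgebra ℚ P} (hv : ∀ r, Commute v r)
    (hk : ∀ (S : Type) [CommRing S] [Algebra ℚ S] (φ : MonoidAlgebra ℚ P →ₐ[ℚ] S), φ v = 0)
    (hf : Function.Injective f) {g : P} {i j k : ℤ} (hg : f g = refl i j k) : v.coeff g = 0 := by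
  classical
  obtain ⟨u, hu⟩ : rot 0 1 1 ∈ f.range := hrange ▸ rot_mem_fibre (by simp) (by simp)
  have hg' : refl i j k ∈ fibre n m l 0 := hrange ▸ ⟨g, hg⟩
  rw [refl_mem_fibre_iff hn hm, zero_mul, add_zero] at hg'
  have hconst : ∀ h : P, (f h).1 = (f g).1 → v.coeff h = v.coeff g := by
    intro h hh
    have hmem : f h ∈ fibre n m l 0 := hrange ▸ ⟨h, rfl⟩
    obtain ⟨i', j', k', h1 | h1⟩ := exists_eq_rot_or_eq_refl (f h)
    · rw [h1, rot_mem_fibre_iff hn hm, zero_mul, add_zero] at hmem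
      have h2 : (rot i' j' 0 : Ambient n m l) = rot i j 0 := by
        rw [h1, hg] at hh
        exact Prod.ext hh rfl
      rw [rot_eq_rot_iff] at h2
      exact absurd ((even_iff_of_modEq_two (modEq_two_of_modEq_two_pow hn h2.1)).1 hmem.1)
        (Int.not_even_iff_odd.2 hg'.1)
    · rw [h1, refl_mem_fibre_iff hn hm, zero_mul, add_zero] at hmem
      have h2 : (refl i' j' 0 : Ambient n m l) = refl i j 0 := by
        rw [h1, hg] at hh
        exact Prod.ext hh rfl
      rw [refl_eq_refl_iff] at h2
      have h3 : Even (k' - j) := (even_iff_of_modEq_two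
        ((modEq_two_of_modEq_two_pow hm h2.2.1).sub_left k')).1 hmem.2
      obtain ⟨t, ht⟩ := hg'.2.sub h3
      rw [← coeff_conj_of_commute hv (u ^ t) g]
      congr 1
      apply hf
      rw [map_mul, map_mul, map_inv, map_zpow, hu, hg, h1, rot_zpow, rot_mul_refl, rot_inv,
        refl_mul_rot, refl_eq_refl_iff]
      refine ⟨by simpa using h2.1, by simpa using h2.2.1, ?_⟩
      rw [show k - t * 1 + -(t * 1) = k' by linarith]
  have hsum := hk _ (MonoidAlgebra.mapDomainAlgHom ℚ ℚ ((MonoidHom.fst _ _).comp f))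
  have hsum' := congrArg (fun r => r.coeff (f g).1) hsum
  have hsum'' := (Finsupp.mapDomain_apply_eq_sum (fun h => (f h).1) v.coeff (a := g)).symm.trans
    hsum'
  rw [Finset.sum_congr rfl (g := fun _ => v.coeff g)
    (fun a ha => hconst a (Finset.mem_filter.1 ha).2), Finset.sum_const,
    MonoidAlgebra.coeff_zero, Finsupp.zero_apply, smul_eq_zero, Finset.card_eq_zero] at hsum''
  rcases hsum'' with h | h
  · by_contra hne
    have : g ∈ (∅ : Finset P) := h ▸ Finset.mem_filter.2 ⟨Finsupp.mem_support_iff.2 hne, rfl⟩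
    simp at this
  · exact h

/-- A central root would lie in the group algebra of the rotations, an abelian group whose exponent
divides `2 ^ (n - 1)`. -/
theorem not_hasCentralRoot (hnm : m < n) (hml : l < m)
    (hf : Function.Injective f) (hrange : f.range = fibre n m l 0) :
    ¬ HasCentralRoot (2 ^ (n - 1)) (MonoidAlgebra ℚ P) := by
  rintro ⟨v, hv0, hc, hk, hv⟩
  let A := (rotations n m l).comap f
  have hA : IsMulCommutative A := isMulCommutative_comap_rotations hf
  let _ : CommGroup A := { (inferInstance : Group A) with mul_comm := hA.is_comm.comm }
  have hsupp : (v.coeff.support : Set P) ⊆ Set.range A.subtype := by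
    intro g hg
    obtain ⟨i, j, k, h | h⟩ := exists_eq_rot_or_eq_refl (f g)
    · exact ⟨⟨g, Subgroup.mem_comap.2 (h ▸ rot_mem_rotations i j k)⟩, rfl⟩
    · exact absurd (coeff_eq_zero_of_map_eq_refl (by omega) (by omega) hrange hc hk hf h)
        (Finsupp.mem_support_iff.1 hg)
  have hinj : Function.Injective (MonoidAlgebra.mapDomainAlgHom ℚ ℚ A.subtype) :=
    MonoidAlgebra.mapDomain_injective A.subtype_injective
  obtain ⟨w, rfl⟩ : ∃ w, MonoidAlgebra.mapDomainAlgHom ℚ ℚ A.subtype w = v :=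
    ⟨_, MonoidAlgebra.mapDomain_comapDomain hsupp A.subtype_injective⟩
  rw [← map_pow, ← map_neg] at hv
  refine hv0 ?_
  rw [eq_zero_of_pow_eq_neg (by omega) (fun a => ?_) (hinj hv), map_zero]
  -- the rotations have exponent `2 ^ (n - 1)` as their first coordinate is even
  obtain ⟨⟨i, j, k, h⟩, hmem⟩ := And.intro (Subgroup.mem_comap.1 a.2)
    (show f a ∈ fibre n m l 0 from hrange ▸ ⟨a, rfl⟩)
  rw [h, rot_mem_fibre_iff (by omega) (by omega), zero_mul, add_zero] at hmem
  obtain ⟨⟨t, rfl⟩, -⟩ := hmem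
  refine Subtype.ext (hf ?_)
  rw [Subgroup.coe_pow, map_pow, h, rot_pow_two_pow, Subgroup.coe_one, map_one, ← rot_zero,
    rot_eq_rot_iff]
  simp only [Int.modEq_zero_iff_dvd]
  refine ⟨⟨t, ?_⟩, (pow_dvd_pow 2 (by omega)).mul_right _, (pow_dvd_pow 2 (by omega)).mul_right _⟩
  obtain ⟨n, rfl⟩ := Nat.exists_eq_add_of_lt hnm
  rw [Nat.add_sub_cancel, pow_succ]
  ring

end NoRoot

/-! ### The rational group algebra of `GroupG` has a central root -/

section GeomSum

variable {S : Type*} [CommRing S] {N : ℕ} {Y : S}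

theorem mul_geom_sum_eq_self (hY : Y ^ N = 1) :
    Y * ∑ i ∈ Finset.range N, Y ^ i = ∑ i ∈ Finset.range N, Y ^ i := by
  have := mul_geom_sum Y N
  rw [hY, sub_self] at this
  linear_combination this

theorem geom_sum_mul_eq_natCast_mul {a : S} (ha : Y * a = a) :
    (∑ i ∈ Finset.range N, Y ^ i) * a = N * a := by
  have h : ∀ i : ℕ, Y ^ i * a = a := fun i => by
    induction i with
    | zero => simp
    | succ i ih => rw [pow_succ, mul_assoc, ha, ih]
  simp [Finset.sum_mul, h]

/-- Up to the factor `N`, both sides are the idempotent attached to the eigenvalue `1` of `Y`. -/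
theorem geom_sum_eq_geom_sum_of_mul_eq_one [Algebra ℚ S] (hN : N ≠ 0) {Y' : S} (hY : Y ^ N = 1)
    (hYY' : Y * Y' = 1) :
    ∑ i ∈ Finset.range N, Y ^ i = ∑ i ∈ Finset.range N, Y' ^ i := by
  have hY' : Y' ^ N = 1 := by simpa [mul_pow, hY] using congrArg (· ^ N) hYY'
  set t := ∑ i ∈ Finset.range N, Y ^ i with ht
  set t' := ∑ i ∈ Finset.range N, Y' ^ i with ht'
  have h1 : Y * t = t := mul_geom_sum_eq_self hY
  have h2 : Y' * t' = t' := mul_geom_sum_eq_self hY'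
  have h3 : Y * t' = t' := by rw [← h2, ← mul_assoc, hYY', one_mul, h2]
  have h4 : Y' * t = t := by rw [← h1, ← mul_assoc, mul_comm Y', hYY', one_mul, h1]
  have h5 : t * t' = N * t' := geom_sum_mul_eq_natCast_mul h3
  have h6 : t' * t = N * t := geom_sum_mul_eq_natCast_mul h4
  have h7 : (N : ℚ) • t = (N : ℚ) • t' := by
    rw [Nat.cast_smul_eq_nsmul, Nat.cast_smul_eq_nsmul, nsmul_eq_mul, nsmul_eq_mul]
    linear_combination h5 - h6
  exact smul_right_injective S (r := (N : ℚ)) (by exact_mod_cast hN) h7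

/-- On the factor where `Z ^ 2 = -1` and `E = -1` one has `(U + U') ^ 2 = 2 * (U * U')` and
`(W + W') ^ 2 = 2`, and `t * (1 - E)` is `2 * N` times the projection to this factor. Hence `v ^ 2`
is `U * U'` times this projection, and `(U * U') ^ K = E` gives the claim. -/
theorem pow_two_mul_add_one_eq_neg [Algebra ℚ S] {U U' W W' Z E t : S} {K : ℕ} (hN : N ≠ 0)
    (hK0 : K ≠ 0)
    (hU : U * U = U * U' * Z) (hU' : U' * U' * Z = U * U') (hW : W * W' = 1) (hE : W ^ 4 = E)
    (hE2 : E * E = 1) (ht : Z ^ 2 * t = -t) (htt : t * t = N * t) (hK : (U * U') ^ K = E) :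
    let v : S := (4 * N : ℚ)⁻¹ • ((U + U') * (W + W') * (t * (1 - E)))
    v ^ (2 * K + 1) = -v ∧ (v = 0 → t = E * t) := by
  intro v
  have hN' : (N : ℚ) ≠ 0 := by exact_mod_cast hN
  have hNS : algebraMap ℚ S N = (N : S) := map_natCast _ N
  have h1 : (U + U') ^ 2 * t = 2 * (U * U') * t := by
    linear_combination t * hU + U' ^ 2 * ht - Z * t * hU'
  have h2 : (W + W') ^ 2 * (1 - E) = 2 * (1 - E) := by
    have h : W ^ 2 = W' ^ 2 * E := by
      rw [← hE]
      linear_combination (-W ^ 2 * (W * W' + 1)) * hW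
    linear_combination (1 - E) * h + 2 * (1 - E) * hW - W' ^ 2 * hE2
  have h3 : (1 - E) ^ 2 = 2 * (1 - E) := by linear_combination hE2
  have hv : v = algebraMap ℚ S (4 * N : ℚ)⁻¹ * ((U + U') * (W + W') * (t * (1 - E))) :=
    Algebra.smul_def _ _
  set c := algebraMap ℚ S (4 * N : ℚ)⁻¹ with hc
  have hc1 : c * (4 * N) = 1 := by
    rw [← hNS, show (4 : S) = algebraMap ℚ S 4 from (map_ofNat _ 4).symm, ← map_mul, hc, ← map_mul,
      inv_mul_cancel₀ (by positivity), map_one]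
  have hv2 : v ^ 2 = 2 * c * (U * U') * (t * (1 - E)) := by
    have : v ^ 2 = c ^ 2 * (((U + U') ^ 2 * t) * t * ((W + W') ^ 2 * (1 - E)) * (1 - E)) := by
      rw [hv]; ring
    rw [this, h1, h2]
    linear_combination (4 * c ^ 2 * U * U' * (1 - E) ^ 2) * htt
      + (4 * c ^ 2 * U * U' * N * t) * h3 + (2 * c * U * U' * t * (1 - E)) * hc1
  have hfv : 2 * c * (t * (1 - E)) * v = v := by
    rw [hv]
    linear_combination (2 * c ^ 2 * (U + U') * (W + W') * (1 - E) ^ 2) * htt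
      + (2 * c ^ 2 * (U + U') * (W + W') * N * t) * h3
      + (c * (U + U') * (W + W') * (t * (1 - E))) * hc1
  have hpow : ∀ r : ℕ, v ^ (2 * r + 1) = (U * U') ^ r * v := by
    intro r
    induction r with
    | zero => simp
    | succ r ih =>
      rw [show 2 * (r + 1) + 1 = (2 * r + 1) + 2 by ring, pow_add, ih, hv2]
      linear_combination ((U * U') ^ (r + 1)) * hfv
  have hEv : E * v = -v := by
    rw [hv]
    linear_combination (-c * (U + U') * (W + W') * t) * hE2
  refine ⟨by rw [hpow, hK, hEv], fun hv0 => ?_⟩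
  rw [hv0] at hv2
  have h4 : U * U' * (t * (1 - E)) = 0 := by
    linear_combination (-U * U' * (t * (1 - E))) * hc1 - (2 * N) * hv2
  obtain ⟨K, rfl⟩ := Nat.exists_eq_add_one_of_ne_zero hK0
  linear_combination (E * (U * U') ^ K) * h4 - (E * (t * (1 - E))) * hK - (t * (1 - E)) * hE2

end GeomSum

section Root

open Ambient

variable {P : Type} [Group P] {n m l : ℕ} {f : P →* Ambient n m l}

/-- The coefficients at `1` of the two sides are `1` and `0`. -/
theorem geom_sum_neg_sq_ne_single_mul {A : Type*} [CommGroup A] {z e : A} {N : ℕ} (hN : N ≠ 0)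
    (hz : ∀ i < N, i ≠ 0 → z ^ (2 * i) ≠ 1) (he : ∀ i : ℕ, z ^ (2 * i) ≠ e⁻¹) :
    ∑ i ∈ Finset.range N, (-(MonoidAlgebra.of ℚ A z) ^ 2) ^ i ≠
      MonoidAlgebra.of ℚ A e * ∑ i ∈ Finset.range N, (-(MonoidAlgebra.of ℚ A z) ^ 2) ^ i := by
  classical
  have hterm : ∀ i : ℕ, (-(MonoidAlgebra.of ℚ A z) ^ 2) ^ i =
      (-1 : ℚ) ^ i • MonoidAlgebra.single (z ^ (2 * i)) (1 : ℚ) := fun i => by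
    rw [neg_pow, ← pow_mul, ← map_pow (MonoidAlgebra.of ℚ A), Algebra.smul_def,
      map_pow (algebraMap ℚ _), map_neg (algebraMap ℚ _), map_one (algebraMap ℚ _)]
    rfl
  intro h
  have h1 := congrArg (fun r => r.coeff 1) h
  have hR : (MonoidAlgebra.of ℚ A e *
      ∑ i ∈ Finset.range N, (-(MonoidAlgebra.of ℚ A z) ^ 2) ^ i).coeff 1 = 0 := by
    rw [MonoidAlgebra.of_apply, MonoidAlgebra.coeff_single_mul_apply, MonoidAlgebra.coeff_sum,
      Finsupp.finsetSum_apply, Finset.sum_eq_zero, mul_zero]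
    intro i _
    rw [hterm, MonoidAlgebra.coeff_smul_apply, MonoidAlgebra.coeff_single, Finsupp.single_apply, if_neg, smul_zero]
    rw [mul_one]
    exact he i
  have hL : (∑ i ∈ Finset.range N, (-(MonoidAlgebra.of ℚ A z) ^ 2) ^ i).coeff 1 = 1 := by
    rw [MonoidAlgebra.coeff_sum, Finsupp.finsetSum_apply,
      Finset.sum_eq_single_of_mem 0 (Finset.mem_range.2 (Nat.pos_of_ne_zero hN))]
    · simp
    · intro i hi hi0
      rw [hterm, MonoidAlgebra.coeff_smul_apply, MonoidAlgebra.coeff_single, Finsupp.single_apply,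
        if_neg (hz i (Finset.mem_range.1 hi) hi0), smul_zero]
  simp only [hR, hL] at h1
  exact one_ne_zero h1

/-- The central root is a multiple of `(U + U') * (W + W⁻¹) * t * (1 - E)`, where `U` and `U'` are the
rotations `(1, 1, ±1)`, `W` is `x ^ 2 ^ (n - 3)`, `E` is `x ^ 2 ^ (n - 1)`, and `t` is the sum of the
powers of `-z²`. -/
theorem hasCentralRoot (hnm : m < n) (hml : l < m) (hl : 2 ≤ l)
    (hf : Function.Injective f) (hrange : f.range = fibre n m l 1) :
    HasCentralRoot (2 ^ (n - 1)) (MonoidAlgebra ℚ P) := by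
  obtain ⟨n, rfl⟩ := Nat.exists_eq_add_of_le (show 3 ≤ n by omega)
  obtain ⟨l, rfl⟩ := Nat.exists_eq_add_of_le hl
  let A := (rotations (3 + n) m (2 + l)).comap f
  have hA : IsMulCommutative A := isMulCommutative_comap_rotations hf
  let _ : CommGroup A := { (inferInstance : Group A) with mul_comm := hA.is_comm.comm }
  have hex : ∀ i j k : ℤ, Even (i + 1 * j) → Even (k - j) → ∃ a : A, f a = rot i j k := by
    intro i j k h h'
    obtain ⟨a, ha⟩ : rot i j k ∈ f.range := hrange ▸ rot_mem_fibre h h'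
    exact ⟨⟨a, Subgroup.mem_comap.2 (ha ▸ rot_mem_rotations ..)⟩, ha⟩
  have heq : ∀ {a b : A}, f a = f b → a = b := fun h => Subtype.ext (hf h)
  obtain ⟨x, hx⟩ : refl 1 0 0 ∈ f.range := hrange ▸ refl_mem_fibre (by simp) (by simp)
  obtain ⟨y, hy⟩ : refl 0 1 (-1) ∈ f.range := hrange ▸ refl_mem_fibre (by simp) (by simp)
  obtain ⟨u, hu⟩ := hex 1 1 1 (by simp) (by simp)
  obtain ⟨u', hu'⟩ := hex 1 1 (-1) (by simp) (by simp)
  obtain ⟨w, hw⟩ := hex (2 ^ n) 0 0 (by simp [parity_simps]; omega) (by simp)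
  obtain ⟨w', hw'⟩ := hex (-2 ^ n) 0 0 (by simp [parity_simps]; omega) (by simp)
  obtain ⟨z, hz⟩ := hex 0 0 2 (by simp) (by simp)
  obtain ⟨z', hz'⟩ := hex 0 0 (-2) (by simp) (by simp)
  obtain ⟨e, he⟩ := hex (2 ^ (n + 2)) 0 0 (by simp [parity_simps]) (by simp)
  let X := MonoidAlgebra.of ℚ A
  let ι := MonoidAlgebra.mapDomainAlgHom ℚ ℚ A.subtype
  have hι : ∀ a : A, ι (X a) = MonoidAlgebra.of ℚ P a := fun a => MonoidAlgebra.mapDomain_single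
  have hιinj : Function.Injective ι := MonoidAlgebra.mapDomain_injective A.subtype_injective
  set N := 2 ^ (l + 1) with hN
  have hN0 : N ≠ 0 := by positivity
  set t := ∑ i ∈ Finset.range N, (-(X z) ^ 2) ^ i with ht
  have hzz' : -(X z) ^ 2 * -(X z') ^ 2 = 1 := by
    rw [neg_mul_neg, ← mul_pow, ← map_mul, ← map_pow, ← map_one X]
    congr 1
    apply heq
    simp [hz, hz', rot_mul_rot, rot_zero]
  have hZN : (-(X z) ^ 2) ^ N = 1 := by
    rw [Even.neg_pow (by simp [hN, parity_simps]), ← pow_mul, ← map_pow, ← map_one X]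
    congr 1
    apply heq
    rw [hN, ← pow_succ', Subgroup.coe_pow, map_pow, hz, rot_pow_two_pow, Subgroup.coe_one, map_one,
      ← rot_zero, rot_eq_rot_iff]
    refine ⟨by simp, by simp, Int.modEq_zero_iff_dvd.2 ⟨1, by ring⟩⟩
  have htt' : t = ∑ i ∈ Finset.range N, (-(X z') ^ 2) ^ i :=
    geom_sum_eq_geom_sum_of_mul_eq_one hN0 hZN hzz'
  have hYt : -(X z) ^ 2 * t = t := mul_geom_sum_eq_self hZN
  obtain ⟨hv, hv0⟩ := pow_two_mul_add_one_eq_neg (U := X u) (U' := X u') (W := X w) (W' := X w')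
    (Z := X z) (E := X e) (t := t) (K := 2 ^ (n + 1)) hN0 (by positivity)
    (by rw [← map_mul, ← map_mul, ← map_mul]
        exact congrArg X (heq (by simp [hu, hu', hz, rot_mul_rot])))
    (by rw [← map_mul, ← map_mul, ← map_mul]
        exact congrArg X (heq (by simp [hu, hu', hz, rot_mul_rot])))
    (by rw [← map_mul, ← map_one X]
        exact congrArg X (heq (by simp [hw, hw', rot_mul_rot, rot_zero])))
    (by rw [← map_pow]
        refine congrArg X (heq ?_)
        rw [Subgroup.coe_pow, map_pow, hw, he, show 4 = 2 ^ 2 from rfl, rot_pow_two_pow]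
        congr 1
        ring)
    (by rw [← map_mul, ← map_one X]
        refine congrArg X (heq ?_)
        rw [Subgroup.coe_mul, map_mul, he, rot_mul_rot, Subgroup.coe_one, map_one, ← rot_zero,
          rot_eq_rot_iff]
        exact ⟨Int.modEq_zero_iff_dvd.2 ⟨1, by ring⟩, by simp, by simp⟩)
    (by linear_combination -hYt)
    (geom_sum_mul_eq_natCast_mul hYt)
    (by rw [← map_mul, ← map_pow]
        refine congrArg X (heq ?_)
        rw [Subgroup.coe_pow, Subgroup.coe_mul, map_pow, map_mul, hu, hu', rot_mul_rot,
          rot_pow_two_pow, he, rot_eq_rot_iff]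
        refine ⟨by rw [pow_succ _ (n + 1)]; rfl, Int.modEq_zero_iff_dvd.2 ?_, by simp⟩
        rw [one_add_one_eq_two, ← pow_succ]
        exact pow_dvd_pow 2 (by omega))
  set v : MonoidAlgebra ℚ A :=
    (4 * N : ℚ)⁻¹ • ((X u + X u') * (X w + X w') * (t * (1 - X e))) with hvdef
  refine ⟨ι v, ?_, ?_, ?_, ?_⟩
  · rw [Ne, map_eq_zero_iff ι hιinj]
    intro h
    refine geom_sum_neg_sq_ne_single_mul hN0 (fun i hi hi0 h => ?_) (fun i h => ?_) (hv0 h)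
    · have h1 := congrArg (fun a : A => f a) h
      simp only [Subgroup.coe_pow, map_pow, hz, Subgroup.coe_one, map_one] at h1
      rw [← zpow_natCast, rot_zpow, ← rot_zero, rot_eq_rot_iff, Int.modEq_zero_iff_dvd] at h1
      have h2 := h1.2.2
      rw [Int.modEq_zero_iff_dvd] at h2
      have h3 : (2 ^ (2 + l + 1) : ℤ) = 4 * N := by rw [hN]; push_cast; ring
      rw [h3, show ((2 * i : ℕ) : ℤ) * 2 = 4 * i by push_cast; ring] at h2
      have h4 : N ∣ i := by exact_mod_cast Int.dvd_of_mul_dvd_mul_left (by norm_num) h2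
      exact absurd (Nat.le_of_dvd (Nat.pos_of_ne_zero hi0) h4) (by omega)
    · have h1 := congrArg (fun a : A => f a) h
      simp only [Subgroup.coe_pow, map_pow, hz, Subgroup.coe_inv, map_inv, he] at h1
      rw [← zpow_natCast, rot_zpow, rot_inv, rot_eq_rot_iff, mul_zero] at h1
      have h2 := h1.1
      rw [Int.modEq_comm, Int.modEq_zero_iff_dvd, dvd_neg] at h2
      have h3 := Int.le_of_dvd (by positivity) h2
      rw [show 3 + n = n + 2 + 1 by ring, pow_succ] at h3
      have h4 : (0 : ℤ) < 2 ^ (n + 2) := by positivity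
      omega
  · -- it suffices to commute with the abelian subgroup `A` and with the reflection `x`
    have hx1 : ∀ a b : A, f (x * a) = f (b * x) →
        SemiconjBy (MonoidAlgebra.of ℚ P x) (ι (X a)) (ι (X b)) := by
      intro a b hab
      rw [SemiconjBy, hι, hι, ← map_mul, ← map_mul, hf hab]
    have hxt : SemiconjBy (MonoidAlgebra.of ℚ P x) (ι t) (ι t) := by
      nth_rewrite 2 [htt']
      rw [ht, map_sum, map_sum, SemiconjBy, Finset.mul_sum, Finset.sum_mul]
      refine Finset.sum_congr rfl fun i _ => ?_
      rw [map_pow, map_pow, map_neg, map_neg, map_pow, map_pow]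
      refine (((hx1 z z' ?_).pow_right 2).neg_right.pow_right i).eq
      simp [hx, hz, hz', rot_mul_refl, refl_mul_rot]
    have hxv : Commute (MonoidAlgebra.of ℚ P x) (ι v) := by
      rw [hvdef, map_smul]
      refine Commute.smul_right ?_ _
      simp only [map_mul, map_add, map_sub, map_one]
      refine SemiconjBy.mul_right (SemiconjBy.mul_right ?_ ?_) (SemiconjBy.mul_right hxt ?_)
      · have h1 := (hx1 u u' (by simp [hx, hu, hu', rot_mul_refl, refl_mul_rot])).add_right
          (hx1 u' u (by simp [hx, hu, hu', rot_mul_refl, refl_mul_rot]))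
        rwa [add_comm (ι (X u')) (ι (X u))] at h1
      · exact (hx1 w w (by simp [hx, hw, rot_mul_refl, refl_mul_rot, add_comm])).add_right
          (hx1 w' w' (by simp [hx, hw', rot_mul_refl, refl_mul_rot, add_comm]))
      · exact (Commute.one_right _).sub_right
          (hx1 e e (by simp [hx, he, rot_mul_refl, refl_mul_rot, add_comm]))
    have hAv : ∀ a : A, Commute (MonoidAlgebra.of ℚ P a) (ι v) := fun a => by
      rw [← hι]
      exact (Commute.all _ _).map ι
    intro r
    induction r using MonoidAlgebra.induction_linear with
    | zero => exact Commute.zero_right _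
    | add r s hr hs => exact hr.add_right hs
    | single g c =>
      have hg : Commute (MonoidAlgebra.of ℚ P g) (ι v) := by
        by_cases hgA : g ∈ A
        · exact hAv ⟨g, hgA⟩
        · have hxA : x ∉ A := fun h => refl_notMem_rotations 1 0 0 (hx ▸ Subgroup.mem_comap.1 h)
          have h1 : x⁻¹ * g ∈ A := by
            rw [Subgroup.mul_mem_iff_of_index_two (index_comap_rotations hx), inv_mem_iff]
            exact iff_of_false hxA hgA
          have h2 := hxv.mul_left (hAv ⟨_, h1⟩)
          rwa [← map_mul, mul_inv_cancel_left] at h2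
      have h3 := hg.symm.smul_right c
      rwa [MonoidAlgebra.of_apply, MonoidAlgebra.smul_single, smul_eq_mul, mul_one] at h3
  · intro S _ _ φ
    -- the commutator `z` is mapped to `1`, so that `-z² t = t` forces the image of `t` to vanish
    let F : P →* S := (φ : MonoidAlgebra ℚ P →* S).comp (MonoidAlgebra.of ℚ P)
    have hz1 : F z = 1 := by
      have h1 : (z : P) = y⁻¹ * x⁻¹ * y * x := by
        apply hf
        have h2 := comm'_refl_refl (n := 3 + n) (m := m) (l := 2 + l) 0
        rw [← hx, ← hy, comm'] at h2
        rw [hz, ← h2]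
        simp
      have hxu : F x⁻¹ * F x = 1 := by rw [← map_mul, inv_mul_cancel, map_one]
      have hyu : F y⁻¹ * F y = 1 := by rw [← map_mul, inv_mul_cancel, map_one]
      rw [h1, map_mul, map_mul, map_mul]
      linear_combination F y⁻¹ * F y * hxu + hyu
    have ht0 : φ (ι t) = 0 := by
      have h1 : φ (ι (X z)) = 1 := by rw [hι]; exact hz1
      have h2 := congrArg (fun s => φ (ι s)) hYt
      simp only [map_mul, map_neg, map_pow, h1] at h2
      have h3 : (2 : ℚ) • φ (ι t) = 0 := by
        rw [ofNat_smul_eq_nsmul, nsmul_eq_mul]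
        push_cast
        linear_combination -h2
      exact (smul_eq_zero.1 h3).resolve_left two_ne_zero
    rw [hvdef, map_smul, map_smul, map_mul ι, map_mul ι t, map_mul φ, map_mul φ, ht0, zero_mul,
      mul_zero, smul_zero]
  · rw [← map_pow, ← map_neg, ← hv, ← pow_succ', show n + 1 + 1 = 3 + n - 1 by omega]

end Root

/-! ### Cyclic subgroups up to conjugacy -/

theorem Nat.card_quotient_eq_of_representatives {S I : Type*} (r : Setoid S) (F : I → S)
    (hsurj : ∀ s, ∃ i, r s (F i)) (hinj : ∀ i i', r (F i) (F i') → i = i') :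
    Nat.card (Quotient r) = Nat.card I := by
  refine (Nat.card_eq_of_bijective (fun i => Quotient.mk r (F i))
    ⟨fun i i' h => ?_, fun q => ?_⟩).symm
  · exact hinj i i' (Quotient.exact h)
  · obtain ⟨s, rfl⟩ := Quotient.exists_rep q
    obtain ⟨i, hi⟩ := hsurj s
    exact ⟨i, (Quotient.sound hi).symm⟩

theorem exists_mul_modEq_one {t : ℤ} (ht : Odd t) (N : ℕ) :
    ∃ y : ℤ, Odd y ∧ t * y ≡ 1 [ZMOD 2 ^ N] := by
  have hc : IsCoprime t (2 ^ (N + 1)) := by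
    obtain ⟨s, rfl⟩ := ht
    exact IsCoprime.pow_right ⟨1, -s, by ring⟩
  obtain ⟨y, w, h⟩ := hc
  refine ⟨y, ?_, ?_⟩
  · have h1 : Odd (y * t) := by
      rw [eq_sub_of_add_eq h, pow_succ, ← mul_assoc]
      exact odd_one.sub_even (even_two.mul_left _)
    exact (Int.odd_mul.1 h1).1
  · refine (Int.modEq_iff_dvd.2 ⟨2 * w, ?_⟩)
    rw [pow_succ] at h
    linear_combination -h

theorem modEq_mul_of_mul_modEq_one {t y a b : ℤ} {M N : ℕ} (hty : t * y ≡ 1 [ZMOD 2 ^ M])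
    (hN : N ≤ M) (h : b ≡ t * a [ZMOD 2 ^ N]) : a ≡ y * b [ZMOD 2 ^ N] :=
  calc a = 1 * a := (one_mul a).symm
    _ ≡ t * y * a [ZMOD 2 ^ N] := ((hty.of_dvd (pow_dvd_pow 2 hN)).mul_right a).symm
    _ = y * (t * a) := by ring
    _ ≡ y * b [ZMOD 2 ^ N] := h.symm.mul_left y

theorem zpowers_eq_zpowers_iff_exists_odd {P : Type*} [Group P] {N : ℕ} {a h : P}
    (ha : a ^ 2 ^ N = 1) :
    Subgroup.zpowers a = Subgroup.zpowers h ↔ ∃ t : ℤ, Odd t ∧ h = a ^ t := by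
  have ha' : a ^ ((2 : ℤ) ^ N) = 1 := by rw [← ha]; exact_mod_cast zpow_natCast a _
  have hinv : ∀ t : ℤ, Odd t → ∃ y : ℤ, (a ^ t) ^ y = a := fun t ht => by
    obtain ⟨y, -, hy⟩ := exists_mul_modEq_one ht N
    obtain ⟨c, hc⟩ := Int.modEq_iff_dvd.1 hy
    refine ⟨y, ?_⟩
    rw [← zpow_mul, show t * y = 1 - 2 ^ N * c by linarith, zpow_sub, zpow_mul, ha']
    simp
  constructor
  · intro hah
    obtain ⟨t, ht⟩ := Subgroup.mem_zpowers_iff.1 (hah ▸ Subgroup.mem_zpowers h)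
    obtain ⟨s, hs⟩ := Subgroup.mem_zpowers_iff.1 (hah ▸ Subgroup.mem_zpowers a)
    rcases Int.even_or_odd t with h1 | h1
    · have h2 : Odd (1 - t * s) := odd_one.sub_even (h1.mul_right s)
      obtain ⟨y, hy⟩ := hinv _ h2
      have h3 : a ^ (1 - t * s) = 1 := by
        rw [zpow_sub, zpow_mul, ht, hs]; simp
      rw [h3, one_zpow] at hy
      exact ⟨1, odd_one, by rw [← ht, ← hy]; simp⟩
    · exact ⟨t, h1, ht.symm⟩
  · rintro ⟨t, ht, rfl⟩
    obtain ⟨y, hy⟩ := hinv t ht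
    apply le_antisymm <;> rw [Subgroup.zpowers_le]
    · exact Subgroup.mem_zpowers_iff.2 ⟨y, hy⟩
    · exact Subgroup.mem_zpowers_iff.2 ⟨t, rfl⟩

/-- In a group of exponent dividing a power of two, the classes of cyclic subgroups are the classes
of elements up to conjugacy and odd powers. -/
theorem card_cyclicSubgroupClasses {P I : Type*} [Group P] {N : ℕ} (hP : ∀ g : P, g ^ 2 ^ N = 1)
    (F : I → P) (hsurj : ∀ g, ∃ i, ∃ u : P, ∃ t : ℤ, Odd t ∧ F i = u * g ^ t * u⁻¹)
    (hinj : ∀ i i', (∃ u : P, ∃ t : ℤ, Odd t ∧ F i' = u * F i ^ t * u⁻¹) → i = i') :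
    Nat.card (CyclicSubgroupClasses P) = Nat.card I := by
  have key : ∀ g h : P, (∃ u : P, (Subgroup.zpowers g).map (MulAut.conj u).toMonoidHom =
      Subgroup.zpowers h) ↔ ∃ u : P, ∃ t : ℤ, Odd t ∧ h = u * g ^ t * u⁻¹ := by
    intro g h
    refine exists_congr fun u => ?_
    rw [MonoidHom.map_zpowers, zpowers_eq_zpowers_iff_exists_odd (hP _)]
    simp [conj_zpow]
  refine Nat.card_quotient_eq_of_representatives _
    (fun i => ⟨Subgroup.zpowers (F i), inferInstance⟩) ?_ fun i i' h => hinj i i' ((key _ _).1 h)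
  rintro ⟨K, hK⟩
  obtain ⟨g, rfl⟩ := (Subgroup.isCyclic_iff_exists_zpowers_eq_top K).1 hK
  obtain ⟨i, hi⟩ := hsurj g
  exact ⟨i, (key _ _).2 hi⟩

/-! ### Classes of elements of the fibre product in coordinates -/

/-- The relation on the abelian parts of reflections that lie in one class. -/
def ReflRel (n m : ℕ) (i j i' j' : ℤ) : Prop :=
  ∃ t : ℤ, Odd t ∧ i' ≡ t * i [ZMOD 2 ^ n] ∧ j' ≡ t * j [ZMOD 2 ^ m]

/-- The relation on the coordinates of rotations that lie in one class: conjugation by a reflection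
changes the sign of the third coordinate. -/
def RotRel (n m l : ℕ) (i j k i' j' k' : ℤ) : Prop :=
  ∃ t : ℤ, Odd t ∧ i' ≡ t * i [ZMOD 2 ^ n] ∧ j' ≡ t * j [ZMOD 2 ^ m] ∧
    (k' ≡ t * k [ZMOD 2 ^ (l + 1)] ∨ k' ≡ -(t * k) [ZMOD 2 ^ (l + 1)])

/-- The relation `RotRel` on the triples with three even entries. -/
def evenSetoid (n m l : ℕ) : Setoid (ℤ × ℤ × ℤ) where
  r p q := RotRel n m l (2 * p.1) (2 * p.2.1) (2 * p.2.2) (2 * q.1) (2 * q.2.1) (2 * q.2.2)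
  iseqv :=
    { refl := fun p => ⟨1, odd_one, by rw [one_mul], by rw [one_mul], Or.inl (by rw [one_mul])⟩
      symm := by
        rintro p q ⟨t, ht, h1, h2, h3⟩
        obtain ⟨y, hy, hty⟩ := exists_mul_modEq_one ht (n + m + (l + 1))
        have inv : ∀ {N : ℕ}, N ≤ n + m + (l + 1) → ∀ {a b : ℤ}, b ≡ t * a [ZMOD 2 ^ N] →
            a ≡ y * b [ZMOD 2 ^ N] := fun hN _ _ => modEq_mul_of_mul_modEq_one hty hN
        refine ⟨y, hy, inv (by omega) h1, inv (by omega) h2, h3.imp (inv (by omega)) fun h => ?_⟩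
        rw [← mul_neg]
        exact inv (by omega) (by simpa using h.neg)
      trans := by
        rintro p q r ⟨t, ht, h1, h2, h3⟩ ⟨s, hs, h4, h5, h6⟩
        have comp : ∀ {N : ℕ} {a b c s t : ℤ}, b ≡ t * a [ZMOD 2 ^ N] → c ≡ s * b [ZMOD 2 ^ N] →
            c ≡ s * t * a [ZMOD 2 ^ N] := fun hb hc => by
          rw [mul_assoc]
          exact hc.trans (hb.mul_left _)
        refine ⟨s * t, hs.mul ht, comp h1 h4, comp h2 h5, ?_⟩
        rw [← neg_mul] at h3 h6 ⊢
        rcases h3 with h3 | h3 <;> rcases h6 with h6 | h6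
        · exact Or.inl (comp h3 h6)
        · exact Or.inr (by simpa using comp h3 h6)
        · exact Or.inr (by simpa using comp h3 h6)
        · exact Or.inl (by simpa using comp h3 h6) }

section Classes

open Ambient

variable {P : Type} [Group P] {n m l : ℕ} {e : ℤ} {f : P →* Ambient n m l}

theorem pow_two_pow_eq_one (hf : Function.Injective f) (hn : 0 < n) (hmn : m ≤ n) (hln : l + 1 ≤ n)
    (g : P) : g ^ 2 ^ n = 1 := by
  apply hf
  rw [map_pow, map_one, ← rot_zero]
  obtain ⟨i, j, k, h | h⟩ := exists_eq_rot_or_eq_refl (f g)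
  · rw [h, rot_pow_two_pow, rot_eq_rot_iff]
    simp only [Int.modEq_zero_iff_dvd]
    exact ⟨(pow_dvd_pow 2 le_rfl).mul_right _, (pow_dvd_pow 2 hmn).mul_right _,
      (pow_dvd_pow 2 hln).mul_right _⟩
  · rw [h, refl_pow_two_pow hn, rot_eq_rot_iff]
    simp only [Int.modEq_zero_iff_dvd]
    exact ⟨(pow_dvd_pow 2 le_rfl).mul_right _, (pow_dvd_pow 2 hmn).mul_right _, dvd_zero _⟩

theorem refl_conj_odd_zpow_iff (hn : 0 < n) (hm : 0 < m) (hf : Function.Injective f)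
    (hrange : f.range = fibre n m l e) {g h : P} {i j k i' j' k' : ℤ} (hg : f g = refl i j k)
    (hh : f h = refl i' j' k') :
    (∃ u : P, ∃ t : ℤ, Odd t ∧ h = u * g ^ t * u⁻¹) ↔ ReflRel n m i j i' j' := by
  constructor
  · rintro ⟨u, t, ⟨s, rfl⟩, rfl⟩
    rw [map_mul, map_mul, map_inv, map_zpow, hg, refl_zpow_two_mul_add_one] at hh
    refine ⟨2 * s + 1, ⟨s, rfl⟩, ?_⟩
    obtain ⟨a, b, c, hu | hu⟩ := exists_eq_rot_or_eq_refl (f u)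
    · rw [hu, rot_mul_refl, rot_inv, refl_mul_rot, refl_eq_refl_iff] at hh
      exact ⟨by simpa using hh.1.symm, by simpa using hh.2.1.symm⟩
    · rw [hu, refl_mul_refl, refl_inv, rot_mul_refl, refl_eq_refl_iff] at hh
      exact ⟨by simpa using hh.1.symm, by simpa using hh.2.1.symm⟩
  · rintro ⟨t, ⟨s, rfl⟩, h1, h2⟩
    obtain ⟨v, hv⟩ : rot e 1 1 ∈ f.range := hrange ▸ rot_mem_fibre (by simp) (by simp)
    have hk : Even (k - j) :=
      ((refl_mem_fibre_iff hn hm).1 (hrange ▸ ⟨g, hg⟩ : refl i j k ∈ fibre n m l e)).2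
    have hk' : Even (k' - j') :=
      ((refl_mem_fibre_iff hn hm).1 (hrange ▸ ⟨h, hh⟩ : refl i' j' k' ∈ fibre n m l e)).2
    have hk'' : Even (k' - (2 * s + 1) * j) := (even_iff_of_modEq_two
      ((modEq_two_of_modEq_two_pow hm h2).sub_left k')).1 hk'
    obtain ⟨c, hc⟩ := (hk.sub hk'').sub (even_two_mul (s * j))
    refine ⟨v ^ c, 2 * s + 1, ⟨s, rfl⟩, hf ?_⟩
    rw [map_mul, map_mul, map_inv, map_zpow, map_zpow, hg, hh, hv, refl_zpow_two_mul_add_one,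
      rot_zpow, rot_mul_refl, rot_inv, refl_mul_rot, refl_eq_refl_iff]
    refine ⟨by simpa using h1, by simpa using h2, ?_⟩
    rw [show k - c * 1 + -(c * 1) = k' by linarith]

theorem rot_conj_odd_zpow_iff (hf : Function.Injective f)
    (hrange : f.range = fibre n m l e) {g h : P} {i j k i' j' k' : ℤ} (hg : f g = rot i j k)
    (hh : f h = rot i' j' k') :
    (∃ u : P, ∃ t : ℤ, Odd t ∧ h = u * g ^ t * u⁻¹) ↔ RotRel n m l i j k i' j' k' := by
  constructor
  · rintro ⟨u, t, ht, rfl⟩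
    rw [map_mul, map_mul, map_inv, map_zpow, hg, rot_zpow] at hh
    refine ⟨t, ht, ?_⟩
    obtain ⟨a, b, c, hu | hu⟩ := exists_eq_rot_or_eq_refl (f u)
    · rw [hu, rot_mul_rot, rot_inv, rot_mul_rot, rot_eq_rot_iff] at hh
      exact ⟨by simpa using hh.1.symm, by simpa using hh.2.1.symm,
        Or.inl (by simpa using hh.2.2.symm)⟩
    · rw [hu, refl_mul_rot, refl_inv, refl_mul_refl, rot_eq_rot_iff] at hh
      exact ⟨by simpa using hh.1.symm, by simpa using hh.2.1.symm,
        Or.inr (by simpa using hh.2.2.symm)⟩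
  · rintro ⟨t, ht, h1, h2, h3 | h3⟩
    · refine ⟨1, t, ht, hf ?_⟩
      rw [one_mul, inv_one, mul_one, map_zpow, hg, hh, rot_zpow, rot_eq_rot_iff]
      exact ⟨h1, h2, h3⟩
    · obtain ⟨x, hx⟩ : refl 1 0 0 ∈ f.range := hrange ▸ refl_mem_fibre (by simp) (by simp)
      refine ⟨x, t, ht, hf ?_⟩
      rw [map_mul, map_mul, map_inv, map_zpow, hg, hh, hx, rot_zpow, refl_mul_rot, refl_inv,
        refl_mul_refl, rot_eq_rot_iff]
      exact ⟨by simpa using h1, by simpa using h2, by simpa using h3⟩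

theorem not_conj_odd_zpow_of_rot_refl {g h : P} {i j k i' j' k' : ℤ}
    (hgh : f g = rot i j k ∧ f h = refl i' j' k' ∨ f g = refl i j k ∧ f h = rot i' j' k') :
    ¬ ∃ u : P, ∃ t : ℤ, Odd t ∧ h = u * g ^ t * u⁻¹ := by
  rintro ⟨u, t, ⟨s, rfl⟩, rfl⟩
  obtain ⟨a, b, c, hu | hu⟩ := exists_eq_rot_or_eq_refl (f u) <;>
    rcases hgh with ⟨hg, hh⟩ | ⟨hg, hh⟩ <;>
    rw [map_mul, map_mul, map_inv, map_zpow, hg, hu] at hh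
  · rw [rot_zpow, rot_mul_rot, rot_inv, rot_mul_rot] at hh
    exact rot_ne_refl hh
  · rw [refl_zpow_two_mul_add_one, rot_mul_refl, rot_inv, refl_mul_rot] at hh
    exact rot_ne_refl hh.symm
  · rw [rot_zpow, refl_mul_rot, refl_inv, refl_mul_refl] at hh
    exact rot_ne_refl hh
  · rw [refl_zpow_two_mul_add_one, refl_mul_refl, refl_inv, rot_mul_refl] at hh
    exact rot_ne_refl hh.symm

/-- The classes of elements are those of reflections, of rotations whose second coordinate is even,
and of rotations whose second coordinate is odd. Those of the second kind do not depend on `e`. -/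
theorem card_cyclicSubgroupClasses_of_representatives {IA IB : Type} [Finite P] (hn : 0 < n)
    (hm : 0 < m) (hmn : m ≤ n) (hln : l + 1 ≤ n) (hf : Function.Injective f)
    (hrange : f.range = fibre n m l e)
    (FA : IA → ℤ × ℤ) (FB : IB → ℤ × ℤ × ℤ)
    (hA : ∀ a, Odd ((FA a).1 + e * (FA a).2))
    (hAs : ∀ i j, Odd (i + e * j) → ∃ a, ReflRel n m i j (FA a).1 (FA a).2)
    (hAi : ∀ a a', ReflRel n m (FA a).1 (FA a).2 (FA a').1 (FA a').2 → a = a')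
    (hB : ∀ b, Even ((FB b).1 + e) ∧ Odd (FB b).2.1 ∧ Odd (FB b).2.2)
    (hBs : ∀ i j k, Even (i + e) → Odd j → Odd k →
      ∃ b, RotRel n m l i j k (FB b).1 (FB b).2.1 (FB b).2.2)
    (hBi : ∀ b b', RotRel n m l (FB b).1 (FB b).2.1 (FB b).2.2 (FB b').1 (FB b').2.1 (FB b').2.2 →
      b = b') :
    Nat.card (CyclicSubgroupClasses P) =
      Nat.card IA + (Nat.card (Quotient (evenSetoid n m l)) + Nat.card IB) := by
  have hexA : ∀ a, ∃ g, f g = refl (FA a).1 (FA a).2 (FA a).2 := fun a => by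
    have : refl (FA a).1 (FA a).2 (FA a).2 ∈ f.range := hrange ▸ refl_mem_fibre (hA a) (by simp)
    exact this
  have hexE : ∀ q : ℤ × ℤ × ℤ, ∃ g, f g = rot (2 * q.1) (2 * q.2.1) (2 * q.2.2) := fun q => by
    have : rot (2 * q.1) (2 * q.2.1) (2 * q.2.2) ∈ f.range :=
      hrange ▸ rot_mem_fibre (by simp [parity_simps]) (by simp [parity_simps])
    exact this
  have hexB : ∀ b, ∃ g, f g = rot (FB b).1 (FB b).2.1 (FB b).2.2 := fun b => by
    have : rot (FB b).1 (FB b).2.1 (FB b).2.2 ∈ f.range := by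
      obtain ⟨h1, h2, h3⟩ := hB b
      refine hrange ▸ rot_mem_fibre ?_ (h3.sub_odd h2)
      obtain ⟨s, hs⟩ := h2
      exact pred_of_eq (h1.add (even_two_mul (e * s))) (by rw [hs]; ring)
    exact this
  choose GA hGA using hexA
  choose GE hGE using hexE
  choose GB hGB using hexB
  let F : IA ⊕ (Quotient (evenSetoid n m l) ⊕ IB) → P :=
    Sum.elim GA (Sum.elim (fun q => GE q.out) GB)
  have hinj : ∀ i i', (∃ u : P, ∃ t : ℤ, Odd t ∧ F i' = u * F i ^ t * u⁻¹) → i = i' := by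
    rintro (a | q | b) (a' | q' | b') h
    · rw [hAi a a' ((refl_conj_odd_zpow_iff hn hm hf hrange (hGA a) (hGA a')).1 h)]
    · exact absurd h (not_conj_odd_zpow_of_rot_refl (Or.inr ⟨hGA a, hGE _⟩))
    · exact absurd h (not_conj_odd_zpow_of_rot_refl (Or.inr ⟨hGA a, hGB b'⟩))
    · exact absurd h (not_conj_odd_zpow_of_rot_refl (Or.inl ⟨hGE _, hGA a'⟩))
    · have h1 : evenSetoid n m l q.out q'.out :=
        (rot_conj_odd_zpow_iff hf hrange (hGE _) (hGE _)).1 h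
      rw [Quotient.out_equiv_out.1 h1]
    · obtain ⟨t, ht, -, h2, -⟩ := (rot_conj_odd_zpow_iff hf hrange (hGE _) (hGB _)).1 h
      have h3 := (even_iff_of_modEq_two (modEq_two_of_modEq_two_pow hm h2)).2
        ((even_two_mul _).mul_left t)
      exact absurd h3 (Int.not_even_iff_odd.2 (hB b').2.1)
    · exact absurd h (not_conj_odd_zpow_of_rot_refl (Or.inl ⟨hGB b, hGA a'⟩))
    · obtain ⟨t, ht, -, h2, -⟩ := (rot_conj_odd_zpow_iff hf hrange (hGB _) (hGE _)).1 h
      have h3 := (even_iff_of_modEq_two (modEq_two_of_modEq_two_pow hm h2)).1 (even_two_mul _)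
      exact absurd h3 (Int.not_even_iff_odd.2 (ht.mul (hB b).2.1))
    · rw [hBi b b' ((rot_conj_odd_zpow_iff hf hrange (hGB b) (hGB b')).1 h)]
  have hsurj : ∀ g, ∃ i, ∃ u : P, ∃ t : ℤ, Odd t ∧ F i = u * g ^ t * u⁻¹ := by
    intro g
    have hmem : f g ∈ fibre n m l e := hrange ▸ ⟨g, rfl⟩
    obtain ⟨i, j, k, h | h⟩ := exists_eq_rot_or_eq_refl (f g)
    · rw [h, rot_mem_fibre_iff hn hm] at hmem
      rcases Int.even_or_odd j with hj | hj
      · obtain ⟨i₁, hi₁⟩ : Even i := by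
          have := hmem.1.sub (hj.mul_left e)
          rwa [add_sub_cancel_right] at this
        obtain ⟨k₁, hk₁⟩ : Even k := by
          have := hmem.2.add hj
          rwa [sub_add_cancel] at this
        obtain ⟨j₁, hj₁⟩ := hj
        rw [← two_mul] at hi₁ hj₁ hk₁
        subst hi₁ hj₁ hk₁
        refine ⟨Sum.inr (Sum.inl (Quotient.mk _ (i₁, j₁, k₁))), ?_⟩
        refine (rot_conj_odd_zpow_iff hf hrange h (hGE _)).2 ?_
        exact (evenSetoid n m l).symm (Quotient.mk_out (s := evenSetoid n m l) (i₁, j₁, k₁))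
      · obtain ⟨s, hs⟩ := hj
        obtain ⟨b, hb⟩ := hBs i j k
          (pred_of_eq (hmem.1.sub (even_two_mul (e * s))) (by rw [hs]; ring)) ⟨s, hs⟩
          (by have := hmem.2.add_odd ⟨s, hs⟩; rwa [sub_add_cancel] at this)
        exact ⟨Sum.inr (Sum.inr b), (rot_conj_odd_zpow_iff hf hrange h (hGB _)).2 hb⟩
    · rw [h, refl_mem_fibre_iff hn hm] at hmem
      obtain ⟨a, ha⟩ := hAs i j hmem.1
      exact ⟨Sum.inl a, (refl_conj_odd_zpow_iff hn hm hf hrange h (hGA _)).2 ha⟩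
  have hfin : Finite (IA ⊕ (Quotient (evenSetoid n m l) ⊕ IB)) :=
    Finite.of_injective F fun i i' h => hinj i i' ⟨1, 1, odd_one, by simp [h]⟩
  have hfin1 : Finite IA := Finite.of_injective _ (Sum.inl_injective (β := Quotient (evenSetoid n m l) ⊕ IB))
  have hfin2 : Finite (Quotient (evenSetoid n m l) ⊕ IB) :=
    Finite.of_injective _ (Sum.inr_injective (α := IA))
  have hfin3 : Finite (Quotient (evenSetoid n m l)) :=
    Finite.of_injective _ (Sum.inl_injective (β := IB))
  have hfin4 : Finite IB :=
    Finite.of_injective _ (Sum.inr_injective (α := Quotient (evenSetoid n m l)))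
  rw [card_cyclicSubgroupClasses (pow_two_pow_eq_one hf hn hmn hln) F hsurj hinj, Nat.card_sum,
    Nat.card_sum]

end Classes

/-! ### Counting orbits -/

/-- Integers modulo `2 ^ N` up to multiplication by odd integers congruent to `1` modulo `2 ^ m`. -/
def orbitSetoid (m N : ℕ) : Setoid ℤ where
  r a b := ∃ t : ℤ, Odd t ∧ t ≡ 1 [ZMOD 2 ^ m] ∧ b ≡ t * a [ZMOD 2 ^ N]
  iseqv :=
    { refl := fun a => ⟨1, odd_one, rfl, by rw [one_mul]⟩
      symm := by
        rintro a b ⟨t, hodd, ht, h⟩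
        obtain ⟨y, hy, hty⟩ := exists_mul_modEq_one hodd (m + N)
        refine ⟨y, hy, ?_, modEq_mul_of_mul_modEq_one hty (by omega) h⟩
        have h1 : 1 ≡ y * 1 [ZMOD 2 ^ m] :=
          modEq_mul_of_mul_modEq_one hty (by omega) (by simpa using ht.symm)
        rw [mul_one] at h1
        exact h1.symm
      trans := by
        rintro a b c ⟨t, hodd, ht, h⟩ ⟨s, hodd', hs, h'⟩
        exact ⟨s * t, hodd'.mul hodd, by simpa using hs.mul ht,
          by rw [mul_assoc]; exact h'.trans (h.mul_left s)⟩ }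

theorem exists_lt_modEq (a : ℤ) (m : ℕ) : ∃ r : Fin (2 ^ m), (r : ℤ) ≡ a [ZMOD 2 ^ m] := by
  have h1 : 0 ≤ a % 2 ^ m := Int.emod_nonneg _ (by positivity)
  have h2 : a % 2 ^ m < 2 ^ m := Int.emod_lt_of_pos _ (by positivity)
  refine ⟨⟨(a % 2 ^ m).toNat, ?_⟩, ?_⟩
  · zify
    rwa [Int.toNat_of_nonneg h1]
  · simp only [Int.toNat_of_nonneg h1]
    exact Int.mod_modEq _ _

theorem fin_eq_of_modEq {m : ℕ} {r r' : Fin (2 ^ m)} (h : (r : ℤ) ≡ r' [ZMOD 2 ^ m]) : r = r' := by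
  have h' : (r : ℕ) ≡ r' [MOD 2 ^ m] := by
    rw [← Int.natCast_modEq_iff]; exact_mod_cast h
  exact Fin.ext (Nat.ModEq.eq_of_lt_of_lt h' r.2 r'.2)

theorem two_mul_modEq_two_mul_iff {a b : ℤ} {m : ℕ} :
    2 * a ≡ 2 * b [ZMOD 2 ^ (m + 1)] ↔ a ≡ b [ZMOD 2 ^ m] := by
  rw [pow_succ']
  exact ⟨fun h => h.mul_left_cancel' two_ne_zero, fun h => h.mul_left' ..⟩

theorem exists_two_mul_add_one_modEq {a : ℤ} (ha : Odd a) (m : ℕ) :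
    ∃ r : Fin (2 ^ m), 2 * (r : ℤ) + 1 ≡ a [ZMOD 2 ^ (m + 1)] := by
  obtain ⟨c, rfl⟩ := ha
  obtain ⟨r, hr⟩ := exists_lt_modEq c m
  exact ⟨r, (two_mul_modEq_two_mul_iff.2 hr).add_right 1⟩

theorem fin_eq_of_two_mul_add_one_modEq {m : ℕ} {r r' : Fin (2 ^ m)}
    (h : 2 * (r : ℤ) + 1 ≡ 2 * r' + 1 [ZMOD 2 ^ (m + 1)]) : r = r' :=
  fin_eq_of_modEq (two_mul_modEq_two_mul_iff.1 (h.add_right_cancel' 1))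

theorem not_two_mul_modEq_odd {m : ℕ} {a b : ℤ} (hb : Odd b) :
    ¬ 2 * a ≡ b [ZMOD 2 ^ (m + 1)] := fun h =>
  Int.not_even_iff_odd.2 hb ((Ambient.even_iff_of_modEq_two
    (Ambient.modEq_two_of_modEq_two_pow m.succ_pos h)).1 (even_two_mul a))

/-- The even integers modulo `2 ^ (N + 1)` are a copy of the integers modulo `2 ^ N`, and the orbits
of the odd ones are the odd residue classes modulo `2 ^ m`. -/
theorem card_orbitSetoid (m d : ℕ) :
    Nat.card (Quotient (orbitSetoid (m + 1) (m + 1 + d))) = (d + 2) * 2 ^ m := by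
  induction d with
  | zero =>
    rw [Nat.card_quotient_eq_of_representatives _ (fun r : Fin (2 ^ (m + 1)) => (r : ℤ)),
      Nat.card_eq_fintype_card, Fintype.card_fin, zero_add, pow_succ']
    · intro a
      obtain ⟨r, hr⟩ := exists_lt_modEq a (m + 1)
      exact ⟨r, 1, odd_one, rfl, by simpa using hr⟩
    · rintro r r' ⟨t, -, ht, h⟩
      exact (fin_eq_of_modEq (h.trans (by simpa using ht.mul_right (r : ℤ)))).symm
  | succ d ih =>
    let F : Quotient (orbitSetoid (m + 1) (m + 1 + d)) ⊕ Fin (2 ^ m) → ℤ :=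
      Sum.elim (fun q => 2 * q.out) (fun r => 2 * (r : ℤ) + 1)
    have hfin : Finite (Quotient (orbitSetoid (m + 1) (m + 1 + d))) :=
      Nat.finite_of_card_ne_zero (by rw [ih]; positivity)
    rw [Nat.card_quotient_eq_of_representatives _ F, Nat.card_sum, ih, Nat.card_eq_fintype_card,
      Fintype.card_fin]
    · ring
    · intro a
      rcases Int.even_or_odd' a with ⟨c, rfl | rfl⟩
      · obtain ⟨t, hodd, ht, h⟩ := (orbitSetoid (m + 1) (m + 1 + d)).symm
          (Quotient.mk_out (s := orbitSetoid (m + 1) (m + 1 + d)) c)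
        refine ⟨Sum.inl (Quotient.mk _ c), t, hodd, ht, ?_⟩
        change 2 * _ ≡ _ [ZMOD 2 ^ (m + 1 + d + 1)]
        rw [mul_left_comm]
        exact two_mul_modEq_two_mul_iff.2 h
      · have ha : Odd (2 * c + 1) := ⟨c, rfl⟩
        obtain ⟨r, hr⟩ := exists_two_mul_add_one_modEq ha m
        obtain ⟨y, hy, hty⟩ := exists_mul_modEq_one ha (m + 1 + (d + 1))
        refine ⟨Sum.inr r, (2 * r + 1) * y, Odd.mul ⟨r, rfl⟩ hy, ?_, ?_⟩
        · exact (hr.mul_right y).trans (hty.of_dvd (pow_dvd_pow 2 (by omega)))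
        · have := hty.mul_left (2 * (r : ℤ) + 1)
          rw [mul_one] at this
          exact this.symm.trans (by rw [mul_comm (2 * c + 1), mul_assoc])
    · rintro (q | r) (q' | r') ⟨t, hodd, ht, h⟩
      · change 2 * _ ≡ _ * (2 * _) [ZMOD 2 ^ (m + 1 + d + 1)] at h
        rw [mul_left_comm, two_mul_modEq_two_mul_iff] at h
        rw [Quotient.out_equiv_out.1 (show orbitSetoid (m + 1) (m + 1 + d) q.out q'.out from
          ⟨t, hodd, ht, h⟩)]
      · change 2 * (r' : ℤ) + 1 ≡ t * (2 * q.out) [ZMOD 2 ^ (m + 1 + d + 1)] at h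
        rw [mul_left_comm] at h
        exact absurd h.symm (not_two_mul_modEq_odd ⟨r', rfl⟩)
      · exact absurd h (not_two_mul_modEq_odd (m := m + 1 + d) (hodd.mul ⟨r, rfl⟩))
      · have h1 : 2 * (r' : ℤ) + 1 ≡ t * (2 * r + 1) [ZMOD 2 ^ (m + 1)] :=
          h.of_dvd (pow_dvd_pow 2 (by omega))
        have h2 : t * (2 * r + 1) ≡ 1 * (2 * r + 1) [ZMOD 2 ^ (m + 1)] := ht.mul_right _
        rw [one_mul] at h2
        rw [fin_eq_of_two_mul_add_one_modEq (h1.trans h2)]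

theorem exists_modEq_or_modEq_neg {k : ℤ} (hk : Odd k) (l : ℕ) :
    ∃ r : Fin (2 ^ l), 2 * (r : ℤ) + 1 ≡ k [ZMOD 2 ^ (l + 2)] ∨
      2 * (r : ℤ) + 1 ≡ -k [ZMOD 2 ^ (l + 2)] := by
  obtain ⟨s, hs⟩ := exists_two_mul_add_one_modEq hk (l + 1)
  have hlt : (s : ℕ) < 2 ^ l * 2 := by rw [← pow_succ]; exact s.2
  rcases lt_or_ge (s : ℕ) (2 ^ l) with h | h
  · exact ⟨⟨s, h⟩, Or.inl hs⟩
  · refine ⟨⟨2 ^ l * 2 - 1 - s, by omega⟩, Or.inr ?_⟩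
    have h1 : (2 * (2 ^ l * 2 - 1 - (s : ℕ) : ℕ) + 1 : ℤ) = 2 ^ (l + 2) - (2 * s + 1) := by
      push_cast [Nat.sub_sub, Nat.cast_sub (show 1 + (s : ℕ) ≤ 2 ^ l * 2 by omega)]
      ring
    simp only [h1]
    simpa using (Int.modEq_zero_iff_dvd.2 dvd_rfl).sub hs

theorem fin_eq_of_modEq_or_modEq_neg {l : ℕ} {r r' : Fin (2 ^ l)}
    (h : 2 * (r : ℤ) + 1 ≡ 2 * r' + 1 [ZMOD 2 ^ (l + 2)] ∨
      2 * (r : ℤ) + 1 ≡ -(2 * r' + 1) [ZMOD 2 ^ (l + 2)]) : r = r' := by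
  rcases h with h | h
  · exact fin_eq_of_two_mul_add_one_modEq (h.of_dvd (pow_dvd_pow 2 (by omega)))
  · exfalso
    have h1 := Int.le_of_dvd (by linarith [r.val.cast_nonneg (α := ℤ), r'.val.cast_nonneg (α := ℤ)])
      (Int.modEq_iff_dvd.1 h.symm)
    have hr := r.2
    have hr' := r'.2
    zify at hr hr'
    rw [pow_add] at h1
    linarith

section Representatives

variable {n m l : ℕ}

/-- An odd first coordinate can be scaled to `1`. -/
theorem exists_odd_mul_modEq_one_left {i : ℤ} (hi : Odd i) :
    ∃ t : ℤ, Odd t ∧ 1 ≡ t * i [ZMOD 2 ^ n] := by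
  obtain ⟨t, ht, h⟩ := exists_mul_modEq_one hi n
  exact ⟨t, ht, by rw [mul_comm]; exact h.symm⟩

/-- If `i` is even and `j` is odd, then `j` can be scaled to `1` and `i / 2` at the same time to the
chosen representative of its class for `orbitSetoid`. -/
theorem exists_odd_mul_modEq_out {i j : ℤ} (hi : Even i) (hj : Odd j) :
    ∃ (q : Quotient (orbitSetoid m n)) (t : ℤ), Odd t ∧ 2 * q.out ≡ t * i [ZMOD 2 ^ (n + 1)] ∧
      1 ≡ t * j [ZMOD 2 ^ m] := by
  obtain ⟨c, rfl⟩ := hi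
  obtain ⟨y, hy, hjy⟩ := exists_mul_modEq_one hj m
  obtain ⟨t, hodd, ht, h⟩ := (orbitSetoid m n).symm
    (Quotient.mk_out (s := orbitSetoid m n) (y * c))
  refine ⟨Quotient.mk _ (y * c), t * y, hodd.mul hy, ?_, ?_⟩
  · rw [show t * y * (c + c) = 2 * (t * (y * c)) by ring]
    exact two_mul_modEq_two_mul_iff.2 h
  · rw [mul_assoc, mul_comm y]
    simpa using (ht.mul hjy).symm

theorem out_eq_of_modEq {q q' : Quotient (orbitSetoid m n)} {t : ℤ} (hodd : Odd t)
    (h : 2 * q'.out ≡ t * (2 * q.out) [ZMOD 2 ^ (n + 1)]) (ht : 1 ≡ t * 1 [ZMOD 2 ^ m]) :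
    q = q' := by
  rw [mul_left_comm, two_mul_modEq_two_mul_iff] at h
  exact Quotient.out_equiv_out.1 (show orbitSetoid m n q.out q'.out from
    ⟨t, hodd, by simpa using ht.symm, h⟩)

end Representatives

/-! ### The numbers of classes of cyclic subgroups -/

section Counts

theorem fin_eq_of_modEq_mul {l N : ℕ} {r r' : Fin (2 ^ l)} {t : ℤ} (hN : l + 2 ≤ N)
    (ht : 1 ≡ t * 1 [ZMOD 2 ^ N])
    (h : 2 * (r' : ℤ) + 1 ≡ t * (2 * r + 1) [ZMOD 2 ^ (l + 2)] ∨
      2 * (r' : ℤ) + 1 ≡ -(t * (2 * r + 1)) [ZMOD 2 ^ (l + 2)]) : r = r' := by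
  have h1 : t * (2 * (r : ℤ) + 1) ≡ 2 * r + 1 [ZMOD 2 ^ (l + 2)] := by
    have := ((ht.of_dvd (pow_dvd_pow 2 hN)).mul_right (2 * (r : ℤ) + 1)).symm
    rwa [mul_one, one_mul] at this
  exact (fin_eq_of_modEq_or_modEq_neg (h.imp (·.trans h1) (·.trans h1.neg))).symm

open Ambient

variable {P : Type} [Group P] [Finite P] {d m l : ℕ}

/-- Representatives of the reflections are `(1, 2r)` and `(2q, 1)`, and those of the rotations with odd
second coordinate are `(1, 2r + 1, 2s + 1)`. -/
theorem card_cyclicSubgroupClasses_of_range_eq_fibre_one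
    {f : P →* Ambient (m + 1 + d + 1) (m + 1) (l + 1)} (hlm : l < m)
    (hf : Function.Injective f) (hrange : f.range = fibre _ _ _ 1) :
    Nat.card (CyclicSubgroupClasses P) = 2 ^ m + (d + 2) * 2 ^ m +
      (Nat.card (Quotient (evenSetoid (m + 1 + d + 1) (m + 1) (l + 1))) + 2 ^ m * 2 ^ l) := by
  let FA : Fin (2 ^ m) ⊕ Quotient (orbitSetoid (m + 1) (m + 1 + d)) → ℤ × ℤ :=
    Sum.elim (fun r => (1, 2 * r)) (fun q => (2 * q.out, 1))
  let FB : Fin (2 ^ m) × Fin (2 ^ l) → ℤ × ℤ × ℤ := fun b => (1, 2 * b.1 + 1, 2 * b.2 + 1)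
  have hfin : Finite (Quotient (orbitSetoid (m + 1) (m + 1 + d))) :=
    Nat.finite_of_card_ne_zero (by rw [card_orbitSetoid]; positivity)
  rw [card_cyclicSubgroupClasses_of_representatives (by omega) (by omega) (by omega) (by omega) hf
    hrange FA FB, Nat.card_sum, card_orbitSetoid, Nat.card_prod]
  · simp
  · rintro (r | q) <;> simp [FA, parity_simps]
  · intro i j hij
    rw [one_mul] at hij
    rcases Int.even_or_odd i with hi | hi
    · obtain ⟨q, t, ht, h1, h2⟩ := exists_odd_mul_modEq_out (m := m + 1) (n := m + 1 + d) hi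
        ((Int.odd_add.1 hij).not.1 (Int.not_odd_iff_even.2 hi) |> Int.not_even_iff_odd.1)
      exact ⟨Sum.inr q, t, ht, h1, h2⟩
    · obtain ⟨t, ht, h1⟩ := exists_odd_mul_modEq_one_left (n := m + 1 + d + 1) hi
      obtain ⟨c, hc⟩ := ((Int.odd_add.1 hij).1 hi).mul_left t
      obtain ⟨r, hr⟩ := exists_lt_modEq c m
      refine ⟨Sum.inl r, t, ht, h1, ?_⟩
      rw [hc, ← two_mul]
      exact two_mul_modEq_two_mul_iff.2 hr
  · rintro (r | q) (r' | q') ⟨t, ht, h1, h2⟩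
    · have h3 : t * (2 * (r : ℤ)) ≡ 2 * r [ZMOD 2 ^ (m + 1)] := by
        have := ((h1.of_dvd (pow_dvd_pow 2 (by omega : m + 1 ≤ _))).mul_right (2 * (r : ℤ))).symm
        simpa [FA] using this
      rw [fin_eq_of_modEq (two_mul_modEq_two_mul_iff.1 (h2.trans h3))]
    · exact absurd h1 (not_two_mul_modEq_odd (by simpa [FA] using ht))
    · exact absurd h2 (not_two_mul_modEq_odd (by simpa [FA] using ht))
    · rw [out_eq_of_modEq ht h1 h2]
  · rintro ⟨r, s⟩
    simp [FB, parity_simps]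
  · intro i j k hi hj hk
    obtain ⟨t, ht, h1⟩ := exists_odd_mul_modEq_one_left (n := m + 1 + d + 1)
      (i := i) (by simpa [parity_simps] using hi)
    obtain ⟨r, hr⟩ := exists_two_mul_add_one_modEq (ht.mul hj) m
    obtain ⟨s, hs⟩ := exists_modEq_or_modEq_neg (ht.mul hk) l
    exact ⟨(r, s), t, ht, h1, hr, hs⟩
  · rintro ⟨r, s⟩ ⟨r', s'⟩ ⟨t, ht, h1, h2, h3⟩
    have h4 : t * (2 * (r : ℤ) + 1) ≡ 2 * r + 1 [ZMOD 2 ^ (m + 1)] := by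
      have := ((h1.of_dvd (pow_dvd_pow 2 (by omega : m + 1 ≤ _))).mul_right
        (2 * (r : ℤ) + 1)).symm
      simpa [FB] using this
    exact Prod.ext (fin_eq_of_two_mul_add_one_modEq (h2.trans h4)).symm
      (fin_eq_of_modEq_mul (N := m + 1 + d + 1) (by omega) h1 h3)

/-- Representatives of the reflections are `(1, r)`, and those of the rotations with odd second
coordinate are `(2q, 1, 2s + 1)`. -/
theorem card_cyclicSubgroupClasses_of_range_eq_fibre_zero
    {f : P →* Ambient (m + 1 + d + 1) (m + 1) (l + 1)} (hlm : l < m)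
    (hf : Function.Injective f) (hrange : f.range = fibre _ _ _ 0) :
    Nat.card (CyclicSubgroupClasses P) = 2 ^ (m + 1) +
      (Nat.card (Quotient (evenSetoid (m + 1 + d + 1) (m + 1) (l + 1))) +
        (d + 2) * 2 ^ m * 2 ^ l) := by
  let FA : Fin (2 ^ (m + 1)) → ℤ × ℤ := fun r => (1, r)
  let FB : Quotient (orbitSetoid (m + 1) (m + 1 + d)) × Fin (2 ^ l) → ℤ × ℤ × ℤ :=
    fun b => (2 * b.1.out, 1, 2 * b.2 + 1)
  rw [card_cyclicSubgroupClasses_of_representatives (by omega) (by omega) (by omega) (by omega) hf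
    hrange FA FB, Nat.card_prod, card_orbitSetoid]
  · simp
  · intro r
    simp [FA]
  · intro i j hij
    obtain ⟨t, ht, h1⟩ := exists_odd_mul_modEq_one_left (n := m + 1 + d + 1)
      (i := i) (by simpa using hij)
    obtain ⟨r, hr⟩ := exists_lt_modEq (t * j) (m + 1)
    exact ⟨r, t, ht, h1, hr⟩
  · rintro r r' ⟨t, ht, h1, h2⟩
    have h3 : t * (r : ℤ) ≡ r [ZMOD 2 ^ (m + 1)] := by
      have := ((h1.of_dvd (pow_dvd_pow 2 (by omega : m + 1 ≤ _))).mul_right (r : ℤ)).symm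
      simpa [FA] using this
    exact (fin_eq_of_modEq (h2.trans h3)).symm
  · rintro ⟨q, s⟩
    simp [FB, parity_simps]
  · intro i j k hi hj hk
    obtain ⟨q, t, ht, h1, h2⟩ := exists_odd_mul_modEq_out (m := m + 1) (n := m + 1 + d) (i := i)
      (by simpa using hi) hj
    obtain ⟨s, hs⟩ := exists_modEq_or_modEq_neg (ht.mul hk) l
    exact ⟨(q, s), t, ht, h1, h2, hs⟩
  · rintro ⟨q, s⟩ ⟨q', s'⟩ ⟨t, ht, h1, h2, h3⟩
    exact Prod.ext (out_eq_of_modEq ht h1 h2)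
      (fin_eq_of_modEq_mul (N := m + 1) (by omega) h2 h3)

end Counts

theorem mainTheorem2 (n m l : ℕ) (hnm : m < n) (hml : l < m) (hl : 2 ≤ l) :
    -- both groups are finite
    (Finite (GroupG n m l) ∧ Finite (GroupH n m l)) ∧
    -- the complex group algebras are isomorphic, the rational ones are not
    Nonempty (MonoidAlgebra ℂ (GroupG n m l) ≃ₐ[ℂ] MonoidAlgebra ℂ (GroupH n m l)) ∧
    IsEmpty (MonoidAlgebra ℚ (GroupG n m l) ≃ₐ[ℚ] MonoidAlgebra ℚ (GroupH n m l)) ∧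
    -- both groups have an abelian maximal subgroup
    (HasAbelianMaximalSubgroup (GroupG n m l) ∧ HasAbelianMaximalSubgroup (GroupH n m l)) ∧
    -- all irreducible complex representations have degree 1 or 2
    (∀ (V : Type) [AddCommGroup V] [Module ℂ V] (ρ : Representation ℂ (GroupG n m l) V),
      ρ.IsIrreducible → Module.finrank ℂ V = 1 ∨ Module.finrank ℂ V = 2) ∧
    (∀ (V : Type) [AddCommGroup V] [Module ℂ V] (ρ : Representation ℂ (GroupH n m l) V),
      ρ.IsIrreducible → Module.finrank ℂ V = 1 ∨ Module.finrank ℂ V = 2) ∧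
    -- the numbers of conjugacy classes of cyclic subgroups
    (Nat.card (CyclicSubgroupClasses (GroupH n m l)) : ℤ)
        - (Nat.card (CyclicSubgroupClasses (GroupG n m l)) : ℤ)
      = ((n : ℤ) - (m : ℤ)) * 2 ^ (m - 1) * (2 ^ (l - 1) - 1) ∧
    (0 : ℤ) < ((n : ℤ) - (m : ℤ)) * 2 ^ (m - 1) * (2 ^ (l - 1) - 1) := by
  obtain ⟨f, hf, hfr, hf0⟩ := GroupG.exists_injective_hom (n := n) (m := m) l (by omega) (by omega)
  obtain ⟨g, hg, hgr, hg0⟩ := GroupH.exists_injective_hom (n := n) (m := m) l (by omega) (by omega)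
  have hfinA : Finite (Ambient n m l) := by
    have : Finite (DihedralGroup (2 ^ (l + 1))) := Finite.of_fintype _
    have : Finite (Multiplicative (ZMod (2 ^ n) × ZMod (2 ^ m))) := Finite.of_fintype _
    exact inferInstance
  have hG : Finite (GroupG n m l) := Finite.of_injective f hf
  have hH : Finite (GroupH n m l) := Finite.of_injective g hg
  have hGi := Ambient.index_comap_rotations hf0
  have hHi := Ambient.index_comap_rotations hg0
  have hGc := Ambient.isMulCommutative_comap_rotations hf
  have hHc := Ambient.isMulCommutative_comap_rotations hg
  refine ⟨⟨hG, hH⟩, nonempty_algEquiv_complex (by omega) (by omega), ⟨fun e => ?_⟩,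
    ⟨⟨_, isCoatom_of_index_two _ hGi, hGc⟩, ⟨_, isCoatom_of_index_two _ hHi, hHc⟩⟩,
    fun V _ _ ρ hρ => finrank_eq_one_or_two_of_index_two _ hGi hGc ρ hρ,
    fun V _ _ ρ hρ => finrank_eq_one_or_two_of_index_two _ hHi hHc ρ hρ, ?_, ?_⟩
  · exact not_hasCentralRoot hnm hml hg hgr ((hasCentralRoot hnm hml hl hf hfr).of_algEquiv e)
  · obtain ⟨m, rfl⟩ : ∃ k, m = k + 1 := ⟨m - 1, by omega⟩
    obtain ⟨l, rfl⟩ : ∃ k, l = k + 1 := ⟨l - 1, by omega⟩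
    obtain ⟨d, rfl⟩ := Nat.exists_eq_add_of_lt hnm
    rw [card_cyclicSubgroupClasses_of_range_eq_fibre_one (by omega) hf hfr,
      card_cyclicSubgroupClasses_of_range_eq_fibre_zero (by omega) hg hgr]
    simp only [Nat.add_sub_cancel]
    push_cast
    ring
  · have h1 : (1 : ℤ) < 2 ^ (l - 1) := one_lt_pow₀ one_lt_two (by omega)
    have h2 : (0 : ℤ) < (n : ℤ) - m := by omega
    have h3 : (0 : ℤ) < 2 ^ (l - 1) - 1 := by linarith
    positivity
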